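/- **Setting.** Let $X$ be a closed subset of a separable Banach space with the induced metric $d_X$, $Y$ a complete separable metric space, $\mathcal H$ a separable real Hilbert space. Let $F\colon X\rightsquigarrow Y$ be a set-valued function with closed graph $Z=\{(x,y): y\in F(x)\}$ and non-empty images $Z_x=F(x)$, and let $g\colon Z\to\mathcal H$, $f\colon\mathcal H\to\mathbb R$. For $\lambda\in\mathcal H$ put $g_\lambda=\langle\lambda,g\rangle$, $G_\lambda(x)=\{g_\lambda(x,y):y\in Z_x\}$ and $\mathbf{BR}_\lambda(x)=\operatorname{argmin}_{y\in Z_x}g_\lambda(x,y)$. Assume: 1. $g$ is bounded; $f$ is convex and differentiable, and $\nabla f$ is $L$-Lipschitz; for every $\lambda\in\nabla f(\mathcal H)$ the function $g_\lambda$ and the set-valued function $G_\lambda$ are lower semicontinuous and $\mathbf{BR}_\lambda$ has non-empty images. 2. $g$ is continuous; every $Z_x$ is compact and $F$ is upper semicontinuous; there is $L_g\ge 0$ such that $\mathcal Z(x)=\{g(x,y):y\in Z_x\}$ is $L_g$-Lipschitz, i.e. $\mathcal Z(x_1)\subseteq \mathcal Z(x_2)+\bar B(0,L_g d_X(x_1,x_2))$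 for all $x_1,x_2\in X$. Let $M=\sup_{Z}\|g\|$, $D=\sup_{z_1,z_2\in Z}\|g(z_1)-g(z_2)\|^2$, $C=\sup_{\mu\in\mathcal P(Z)}\|\nabla f(\int_Z g\,d\mu)\|$. For a Borel probability measure $m$ on $X$ let $\mathcal P_m(Z)$ be the set of Borel probability measures on $Z$ with first marginal $m$, and $\mathrm{val}(P_m)=\inf_{\mu\in\mathcal P_m(Z)}f(\int_Z g\,d\mu)$. Let $d_1(m_0,m_1)=\sup\{\int\varphi\,d m_0-\int\varphi\,d m_1:\varphi\colon X\to\mathbb R\ \text{1-Lipschitz}\}$. **Stochastic Frank–Wolfe (SFW).** Let $x_1,\dots,x_N\in X$ and $m_N=\frac1N\sum_i\delta_{x_i}$. Start from $y^0\in\prod_iZ_{x_i}$. At iteration $k=0,\dots,K-1$ let $\lambda^k=\nabla f(\frac1N\sum_i g(x_i,y_i^k))$, choose $\bar y_i^k\in\mathbf{BR}_{\lambda^k}(x_i)$ for each $i$, and let $n_k\ge1$ be an arbitrary number of simulations. For $j=1,\dots,n_k$ and $i=1,\dots,N$ draw $P_i^{k,j}\sim\mathrm{Bern}(2/(k+2))$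 independently of all previously defined random variables, and set $\hat y_i^{k,j}=\bar y_i^k$ if $P_i^{k,j}=1$, $\hat y^{k,j}_i=y_i^k$ otherwise. Then $y^{k+1}$ is a minimizer of $y\mapsto f(\frac1N\sum_i g(x_i,y_i))$ over $\{\hat y^{k,j}:1\le j\le n_k\}$. **Bridging method.** Given $m_0,m_1$ with finite first moment and $\bar\mu_0\in\mathcal P_{m_0}(Z)$: take a minimizer $\rho$ of $\int d_X(x,x')\,d\rho$ over the couplings of $m_0$ and $m_1$; take a probability measure $\nu$ on $Z\times X$ whose $(x,y)$-marginal is $\bar\mu_0$ and whose $(x,x')$-marginal is $\rho$; take a Borel map $s\colon Z\times X\to Z$ with $s(x,y,x')\in\{(x',y')\in Z:\|g(x',y')-g(x,y)\|\le L_g d_X(x,x')\}$; the output is $s_\#\nu$. **Theorem.** Let $m$ be a Borel probability measure on $X$ with finite first moment, let $1\le K\le 2N$, and let $y^K$ be the outcome of $K$ iterations of SFW. Then the bridging method can be applied to $m_0=m_N$, $m_1=m$ and $\bar\mu_0=\frac1N\sum_i\delta_{(x_i,y_i^K)}$, with an output depending measurably on the random event; every such (random) output $\tilde\mu^K$ belongs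 to $\mathcal P_m(Z)$, $f(\int_Zg\,d\tilde\mu^K)$ is integrable, and $$\mathbb E\Big[f\Big(\int_Z g\,d\tilde\mu^K\Big)\Big]-\mathrm{val}(P_m)\le\frac{4LD}{K}+2L_g(C+LM)\,d_1(m_N,m).$$ -/

import Mathlib

open MeasureTheory ProbabilityTheory
open scoped NNReal ENNReal Pointwise

noncomputable section

namespace MFO

/-! ### Data of the mean field optimization problem -/

section Data

variable {X Y H : Type*}

/-- The graph `Z` of a set-valued function `F`; the fibre `Z_x` is `F x`. -/
def graph (F : X → Set Y) : Set (X × Y) := {p | p.2 ∈ F p.1}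

/-- The point `(x, y)` of the graph, for `y ∈ F x`. -/
def pt (F : X → Set Y) (x : X) (y : F x) : graph F := ⟨(x, (y : Y)), y.2⟩

/-- The set-valued function `x ↦ {g (x, y) | y ∈ Z_x}`. -/
def contributions (F : X → Set Y) (g : graph F → H) (x : X) : Set H :=
  Set.range fun y : F x => g (pt F x y)

/-- A set-valued function is `L`-Lipschitz if `A x₁ ⊆ A x₂ + B(0, L d(x₁, x₂))` (closed ball). -/
def SetLipschitz [PseudoMetricSpace X] [SeminormedAddCommGroup H] (L : ℝ≥0) (A : X → Set H) :
    Prop :=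
  ∀ x₁ x₂, A x₁ ⊆ A x₂ + Metric.closedBall (0 : H) (L * dist x₁ x₂)

variable [NormedAddCommGroup H] [InnerProductSpace ℝ H]

/-- `g_lam (x, y) = ⟨lam, g (x, y)⟩`. -/
def gLin (F : X → Set Y) (g : graph F → H) (lam : H) (z : graph F) : ℝ := inner ℝ lam (g z)

/-- The set-valued function `G_lam (x) = {g_lam (x, y) | y ∈ Z_x}`. -/
def GSet (F : X → Set Y) (g : graph F → H) (lam : H) (x : X) : Set ℝ :=
  Set.range fun y : F x => gLin F g lam (pt F x y)

/-- Best responses: `BR_lam (x) = argmin_{y ∈ Z_x} g_lam (x, y)`. -/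
def BR (F : X → Set Y) (g : graph F → H) (lam : H) (x : X) : Set (F x) :=
  {y | ∀ y' : F x, gLin F g lam (pt F x y) ≤ gLin F g lam (pt F x y')}

/-- Standing data: `F` has closed graph and non-empty images. -/
structure IsData [TopologicalSpace X] [TopologicalSpace Y] (F : X → Set Y) : Prop where
  closed_graph : IsClosed (graph F)
  nonempty : ∀ x, (F x).Nonempty

/-- First set of assumptions: `g` bounded, `f` convex and differentiable with `L`-Lipschitz
gradient, and, for each `lam` in the range of the gradient, `g_lam` and `G_lam` are lower
semicontinuous and `BR_lam` has non-empty images. -/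
structure Assumption1 [TopologicalSpace X] [TopologicalSpace Y] [CompleteSpace H]
    (F : X → Set Y) (g : graph F → H) (f : H → ℝ) (L : ℝ≥0) : Prop where
  bounded : ∃ R : ℝ, ∀ z, ‖g z‖ ≤ R
  convex : ConvexOn ℝ Set.univ f
  differentiable : Differentiable ℝ f
  lipschitz_gradient : LipschitzWith L (gradient f)
  lsc : ∀ lam ∈ Set.range (gradient f), LowerSemicontinuous (gLin F g lam)
  lsc_set : ∀ lam ∈ Set.range (gradient f), LowerHemicontinuous (GSet F g lam)
  br_nonempty : ∀ lam ∈ Set.range (gradient f), ∀ x, (BR F g lam x).Nonempty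

/-- Second set of assumptions (apart from `X` being a closed subset of a separable Banach space):
`g` is continuous, the sets `Z_x` are compact, `F` is upper semicontinuous, and
`x ↦ {g (x, y) | y ∈ Z_x}` is `Lg`-Lipschitz. -/
structure Assumption2 [PseudoMetricSpace X] [TopologicalSpace Y]
    (F : X → Set Y) (g : graph F → H) (Lg : ℝ≥0) : Prop where
  continuous : Continuous g
  compact : ∀ x, IsCompact (F x)
  usc : UpperHemicontinuous F
  lipschitz : SetLipschitz Lg (contributions F g)

/-- `M = sup_z ‖g z‖`. -/
def constM (F : X → Set Y) (g : graph F → H) : ℝ := ⨆ z, ‖g z‖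

/-- `D = sup_{z₁, z₂} ‖g z₁ - g z₂‖²`. -/
def constD (F : X → Set Y) (g : graph F → H) : ℝ :=
  ⨆ p : graph F × graph F, ‖g p.1 - g p.2‖ ^ 2

variable [MeasurableSpace X] [MeasurableSpace Y]

/-- `C = sup_μ ‖∇f (∫ g dμ)‖` over all probability measures `μ` on `Z`. -/
def constC [CompleteSpace H] (F : X → Set Y) (g : graph F → H) (f : H → ℝ) : ℝ :=
  ⨆ μ : ProbabilityMeasure (graph F), ‖gradient f (∫ z, g z ∂(μ : Measure (graph F)))‖

/-- `P_m(Z)`: the probability measures on `Z` with first marginal `m`. -/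
def admissible (F : X → Set Y) (m : Measure X) : Set (Measure (graph F)) :=
  {μ | IsProbabilityMeasure μ ∧ μ.map (fun z => z.1.1) = m}

/-- The value of the problem `inf_{μ ∈ P_m(Z)} f (∫ g dμ)`. -/
def val (F : X → Set Y) (g : graph F → H) (f : H → ℝ) (m : Measure X) : ℝ :=
  ⨅ μ : admissible F m, f (∫ z, g z ∂(μ : Measure (graph F)))

end Data

/-! ### Measures on `X` -/

section Measures

variable {X : Type*} [MetricSpace X] [MeasurableSpace X]

/-- Finite first moment. -/
def HasFirstMoment (m : Measure X) : Prop := ∃ x₀ : X, Integrable (fun x => dist x x₀) m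

/-- The Kantorovich–Rubinstein distance `sup {∫ φ dm₀ - ∫ φ dm₁ | φ is 1-Lipschitz}`. -/
def d1 (m₀ m₁ : Measure X) : ℝ :=
  ⨆ φ : {φ : X → ℝ // LipschitzWith 1 φ}, ((∫ x, φ.1 x ∂m₀) - ∫ x, φ.1 x ∂m₁)

/-- The empirical distribution `(1/N) ∑ᵢ δ_{pᵢ}`. -/
def empirical {α : Type*} [MeasurableSpace α] {N : ℕ} (p : Fin N → α) : Measure α :=
  (N : ℝ≥0∞)⁻¹ • ∑ i, Measure.dirac (p i)

/-- Transport plans between `m₀` and `m₁`. -/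
def plans (m₀ m₁ : Measure X) : Set (Measure (X × X)) :=
  {ρ | IsProbabilityMeasure ρ ∧ ρ.map Prod.fst = m₀ ∧ ρ.map Prod.snd = m₁}

/-- The transport cost `∫ d(x, x') dρ(x, x')`, with values in `[0, ∞]`. -/
def transportCost (ρ : Measure (X × X)) : ℝ≥0∞ := ∫⁻ p, edist p.1 p.2 ∂ρ

/-- `ρ` solves the optimal transport problem between `m₀` and `m₁` for the cost `d`. -/
def IsOptimalPlan (m₀ m₁ : Measure X) (ρ : Measure (X × X)) : Prop :=
  ρ ∈ plans m₀ m₁ ∧ ∀ ρ' ∈ plans m₀ m₁, transportCost ρ ≤ transportCost ρ'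

end Measures

/-! ### The bridging method -/

section Bridging

variable {X Y H : Type*} [MetricSpace X] [MeasurableSpace X] [MeasurableSpace Y]
  [NormedAddCommGroup H] [InnerProductSpace ℝ H]

/-- `S(x, y, x') = {(x', y') ∈ Z | ‖g (x', y') - g (x, y)‖ ≤ Lg d(x, x')}`. -/
def bridgeSet (F : X → Set Y) (g : graph F → H) (Lg : ℝ≥0) (p : graph F × X) : Set (graph F) :=
  {z | z.1.1 = p.2 ∧ ‖g z - g p.1‖ ≤ Lg * dist p.1.1.1 p.2}

/-- `μ₁` is an output of the bridging method with input `m₀`, `m₁`, `μ₀`: there are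
an optimal plan `ρ` between `m₀` and `m₁`, a probability `ν` on `Z × X` whose
`(x, y)`-marginal is `μ₀` and whose `(x, x')`-marginal is `ρ`, and a
measurable selection `s` of `S`, such that `μ₁ = s # ν`. -/
def IsBridgingOutput (F : X → Set Y) (g : graph F → H) (Lg : ℝ≥0)
    (m₀ m₁ : Measure X) (μ₀ μ₁ : Measure (graph F)) : Prop :=
  ∃ ρ : Measure (X × X), IsOptimalPlan m₀ m₁ ρ ∧
  ∃ ν : Measure (graph F × X), IsProbabilityMeasure ν ∧ ν.map Prod.fst = μ₀ ∧
    ν.map (fun p => (p.1.1.1, p.2)) = ρ ∧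
  ∃ s : graph F × X → graph F, Measurable s ∧ (∀ p, s p ∈ bridgeSet F g Lg p) ∧
    μ₁ = ν.map s

end Bridging

/-! ### The stochastic Frank–Wolfe algorithm -/

section SFW

/-- The step size `ω_k = 2 / (k + 2)`. -/
def stepSize (k : ℕ) : unitInterval :=
  ⟨2 / ((k : ℝ) + 2), by positivity, by
    rw [div_le_one (by positivity)]
    linarith [(Nat.cast_nonneg k : (0 : ℝ) ≤ k)]⟩

variable {X Y H Ω : Type*} [NormedAddCommGroup H] [InnerProductSpace ℝ H]

/-- The aggregate `(1/N) ∑ᵢ g (xᵢ, yᵢ)` of a profile `y ∈ ∏ᵢ Z_{xᵢ}`. -/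
def aggregate (F : X → Set Y) (g : graph F → H) {N : ℕ} (x : Fin N → X)
    (y : (i : Fin N) → F (x i)) : H :=
  (N : ℝ)⁻¹ • ∑ i, g (pt F (x i) (y i))

/-- Candidate profile: the `i`-th agent switches from `yᵢ` to `ybarᵢ` if `Pᵢ = 1`. -/
def candidate (F : X → Set Y) {N : ℕ} (x : Fin N → X) (y ybar : (i : Fin N) → F (x i))
    (P : Fin N → Bool) : (i : Fin N) → F (x i) :=
  fun i => if P i then ybar i else y i

/-- The σ-algebra generated by all the random variables defined before the Bernoulli variable
with index `(k, j, i)` is simulated: the iterates and the best responses up to `k`, and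
the Bernoulli variables whose index is lexicographically smaller. -/
@[reducible] def past [MeasurableSpace Y] (F : X → Set Y) {N : ℕ} (x : Fin N → X) (n : ℕ → ℕ)
    (y ybar : ℕ → Ω → (i : Fin N) → F (x i)) (P : (k : ℕ) → Fin (n k) → Fin N → Ω → Bool)
    (k : ℕ) (j : Fin (n k)) (i : Fin N) : MeasurableSpace Ω :=
  (⨆ l : ℕ, ⨆ _ : l ≤ k, MeasurableSpace.comap (y l) inferInstance) ⊔
  (⨆ l : ℕ, ⨆ _ : l ≤ k, MeasurableSpace.comap (ybar l) inferInstance) ⊔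
  (⨆ l : ℕ, ⨆ j' : Fin (n l), ⨆ i' : Fin N,
    ⨆ _ : l < k ∨ (l = k ∧ ((j' : ℕ) < j ∨ ((j' : ℕ) = j ∧ i' < i))),
      MeasurableSpace.comap (P l j' i') inferInstance)

/-- A run of `K` iterations of the stochastic Frank–Wolfe algorithm at the points `xᵢ`, with
`n k` simulations at iteration `k`, on the probability space `(Ω, Pr)`:
`y k` are the iterates, `ybar k` the best responses, `P k j i` the Bernoulli variables. -/
structure IsSFWRun [MeasurableSpace Y] [MeasurableSpace Ω] [CompleteSpace H]
    (F : X → Set Y) (g : graph F → H) (f : H → ℝ) {N : ℕ} (x : Fin N → X)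
    (K : ℕ) (n : ℕ → ℕ) (Pr : Measure Ω)
    (y ybar : ℕ → Ω → (i : Fin N) → F (x i)) (P : (k : ℕ) → Fin (n k) → Fin N → Ω → Bool) :
    Prop where
  measurable_y : ∀ k ≤ K, Measurable (y k)
  measurable_ybar : ∀ k < K, Measurable (ybar k)
  measurable_P : ∀ k < K, ∀ j i, Measurable (P k j i)
  pos_n : ∀ k < K, 1 ≤ n k
  best_response : ∀ k < K, ∀ ω i,
    ybar k ω i ∈ BR F g (gradient f (aggregate F g x (y k ω))) (x i)
  law_P : ∀ k < K, ∀ j i, Pr.map (P k j i) = bernoulliMeasure true false (stepSize k)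
  indep_P : ∀ k < K, ∀ j i,
    Indep (MeasurableSpace.comap (P k j i) inferInstance) (past F x n y ybar P k j i) Pr
  update_mem : ∀ k < K, ∀ ω, ∃ j,
    y (k + 1) ω = candidate F x (y k ω) (ybar k ω) (fun i => P k j i ω)
  update_min : ∀ k < K, ∀ ω j, f (aggregate F g x (y (k + 1) ω)) ≤
    f (aggregate F g x (candidate F x (y k ω) (ybar k ω) (fun i => P k j i ω)))

end SFW

end MFO

end

/-! ### Convex functions with Lipschitz gradient -/

section Gradient

variable {H : Type*} [NormedAddCommGroup H] [InnerProductSpace ℝ H] [CompleteSpace H]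

/-! The error splits into an optimization error for the discretized problem, with marginal `m_N`,
and two transport errors, each at most `C * Lg * d1 m_N m`.

Optimization (`MFO.IsSFWRun.integral_cost_le`): since each new iterate minimizes over all
simulations, its cost is at most that of one simulated candidate, to which the descent inequality
applies. In expectation the linear term is `ω_k` times the Frank–Wolfe gap, which convexity and
optimality of the best responses compare with the cost of any admissible measure. The pairwise
independent Bernoulli draws make the quadratic term at most `L D / 2 * (ω_k² + ω_k (1 - ω_k) / N)`.
The resulting recursion gives `4 L D / K` when `K ≤ 2 N`.

Transport: the set-valued Lipschitz condition moves a point of `Z` from base `x` to base `x'` while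
changing `g` by at most `Lg * d(x, x')`. A measurable choice of this move exists because the sets
`bridgeSet` are compact and hit closed sets measurably. Integrating against a plan of cost `d1`
moves the aggregate by at most `Lg * d1`, and the tangent inequality turns this into `C * Lg * d1`
for the cost (`MFO.cost_sub_le`). This is used from `m_N` to `m` for the output, and from `m` to
`m_N` for an arbitrary competitor.

That optimal plans cost `d1` is semi-discrete Kantorovich–Rubinstein duality. A plan is encoded by
weights `w_i` on `X` summing to one, each of mass `1 / N`; their existence follows from Hahn–Banach
separation in finite dimension (`exists_isAllocation_of_forall_partition`). The same weights give
explicit gluings, so no disintegration is needed. -/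

theorem hasDerivAt_comp_add_smul {f : H → ℝ} (hf : Differentiable ℝ f)
    (b v : H) (t : ℝ) :
    HasDerivAt (fun t : ℝ => f (b + t • v)) (inner ℝ (gradient f (b + t • v)) v) t := by
  have h1 := (hf (b + t • v)).hasGradientAt.hasFDerivAt
  have h2 : HasDerivAt (fun t : ℝ => b + t • v) v t := by
    simpa using ((hasDerivAt_id t).smul_const v).const_add b
  exact h1.comp_hasDerivAt t h2

/-- A differentiable convex function lies above its tangents. -/
theorem ConvexOn.add_inner_gradient_le {f : H → ℝ} (hc : ConvexOn ℝ Set.univ f)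
    (hf : Differentiable ℝ f) (a b : H) : f b + inner ℝ (gradient f b) (a - b) ≤ f a := by
  have h1 := hasDerivAt_comp_add_smul hf b (a - b) 0
  have h2 : ConvexOn ℝ Set.univ (fun t : ℝ => f (b + t • (a - b))) := by
    have := hc.comp_affineMap (AffineMap.lineMap b a)
    have heq : (fun t : ℝ => f (b + t • (a - b))) = f ∘ AffineMap.lineMap b a := by
      ext t
      simp [AffineMap.lineMap_apply, add_comm]
    rwa [heq]
  have h3 := h2.le_slope_of_hasDerivAt (Set.mem_univ 0) (Set.mem_univ 1) zero_lt_one h1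
  simp only [zero_smul, add_zero, slope, sub_zero, inv_one, one_smul, vsub_eq_sub,
    add_sub_cancel] at h3
  linarith

/-- The descent inequality for functions with Lipschitz gradient. -/
theorem LipschitzWith.le_add_inner_gradient_add {f : H → ℝ} {L : ℝ≥0}
    (hL : LipschitzWith L (gradient f)) (hf : Differentiable ℝ f) (b v : H) :
    f (b + v) ≤ f b + inner ℝ (gradient f b) v + L / 2 * ‖v‖ ^ 2 := by
  -- The claim is `ψ 1 ≤ ψ 0`. The Lipschitz bound on the gradient along the segment makes the
  -- derivative of `ψ` nonpositive on `(0, 1)`.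
  set ψ : ℝ → ℝ := fun t => f (b + t • v) - (t * inner ℝ (gradient f b) v + L / 2 * ‖v‖ ^ 2 * t ^ 2)
    with hψ
  have hd : ∀ t, HasDerivAt ψ (inner ℝ (gradient f (b + t • v)) v -
      (inner ℝ (gradient f b) v + L / 2 * ‖v‖ ^ 2 * (2 * t))) t := by
    intro t
    refine (hasDerivAt_comp_add_smul hf b v t).sub (HasDerivAt.add ?_ ?_)
    · simpa using (hasDerivAt_id t).mul_const (inner ℝ (gradient f b) v)
    · simpa using (hasDerivAt_pow 2 t).const_mul (L / 2 * ‖v‖ ^ 2 : ℝ)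
  have ha : AntitoneOn ψ (Set.Icc 0 1) := by
    refine antitoneOn_of_deriv_nonpos (convex_Icc 0 1)
      (fun t _ => (hd t).continuousAt.continuousWithinAt)
      (fun t _ => (hd t).differentiableAt.differentiableWithinAt) fun t ht => ?_
    rw [interior_Icc] at ht
    rw [(hd t).deriv]
    have h1 : inner ℝ (gradient f (b + t • v) - gradient f b) v ≤ L * (t * ‖v‖) * ‖v‖ := by
      refine (real_inner_le_norm _ _).trans (mul_le_mul_of_nonneg_right ?_ (norm_nonneg _))
      have := hL.norm_sub_le (b + t • v) b
      rwa [add_sub_cancel_left, norm_smul, Real.norm_of_nonneg ht.1.le] at this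
    rw [inner_sub_left] at h1
    nlinarith
  have := ha (Set.left_mem_Icc.2 zero_le_one) (Set.right_mem_Icc.2 zero_le_one) zero_le_one
  simp only [hψ, zero_smul, one_smul, add_zero, one_mul, zero_mul, one_pow, mul_one,
    zero_pow two_ne_zero, mul_zero, sub_zero] at this
  linarith

end Gradient

/-! ### Measurable selections of compact-valued maps -/

section Selection

open Metric

variable {α Z : Type*} [MeasurableSpace α] [MetricSpace Z]

/-- A compact-valued map with non-empty values which hits closed sets measurably. -/
structure MeasurableCompactValued (S : α → Set Z) : Prop where
  isCompact : ∀ a, IsCompact (S a)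
  nonempty : ∀ a, (S a).Nonempty
  measurable_hit : ∀ C, IsClosed C → MeasurableSet {a | (S a ∩ C).Nonempty}

/-- The points of `S a` closest to `q`. -/
def nearestPoints (q : Z) (S : α → Set Z) (a : α) : Set Z :=
  S a ∩ {z | edist q z ≤ infEDist q (S a)}

/-- By compactness the distance is attained, so it is at most a finite `r` exactly when `S a` meets
the closed set of points of `C` within `r` of `q`. The value `⊤` is separate because it also arises
from an empty intersection. -/
theorem MeasurableCompactValued.measurable_infEDist {S : α → Set Z}
    (hS : MeasurableCompactValued S) (q : Z) {C : Set Z} (hC : IsClosed C) :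
    Measurable fun a => infEDist q (S a ∩ C) := by
  refine measurable_of_Iic fun r => ?_
  rcases eq_or_ne r ⊤ with rfl | hr
  · simp
  convert hS.measurable_hit (C ∩ {z | edist q z ≤ r})
    (hC.inter (isClosed_le (by fun_prop) continuous_const)) using 1
  ext a
  simp only [Set.mem_preimage, Set.mem_Iic, Set.mem_ofPred_eq]
  constructor
  · intro h
    have hne : (S a ∩ C).Nonempty := by
      by_contra hcon
      rw [Set.not_nonempty_iff_eq_empty] at hcon
      rw [hcon, infEDist_empty] at h
      exact hr (top_le_iff.1 h)
    obtain ⟨z, hz, hzq⟩ := ((hS.isCompact a).inter_right hC).exists_infEDist_eq_edist hne q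
    exact ⟨z, hz.1, hz.2, by simpa [← hzq] using h⟩
  · rintro ⟨z, hz1, hz2, hz3⟩
    have hz : z ∈ S a ∩ C := ⟨hz1, hz2⟩
    exact (infEDist_le_edist_of_mem hz).trans hz3

/-- The nearest points meet `C` exactly when the distance from `q` to `S a ∩ C` does not exceed the
distance to `S a`: a comparison of two measurable functions. -/
theorem MeasurableCompactValued.nearestPoints {S : α → Set Z}
    (hS : MeasurableCompactValued S) (q : Z) : MeasurableCompactValued (nearestPoints q S) where
  isCompact a := (hS.isCompact a).inter_right (isClosed_le (by fun_prop) continuous_const)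
  nonempty a := by
    obtain ⟨z, hz, hzq⟩ := (hS.isCompact a).exists_infEDist_eq_edist (hS.nonempty a) q
    exact ⟨z, hz, hzq.ge⟩
  measurable_hit C hC := by
    have h1 : Measurable fun a => infEDist q (S a) := by
      simpa using hS.measurable_infEDist q isClosed_univ
    convert measurableSet_le (hS.measurable_infEDist q hC) h1 using 1
    ext a
    constructor
    · rintro ⟨z, ⟨hz1, hz2⟩, hz3⟩
      have hz : z ∈ S a ∩ C := ⟨hz1, hz3⟩
      exact (infEDist_le_edist_of_mem hz).trans hz2
    · intro h
      simp only [Set.mem_ofPred_eq] at h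
      have hne : (S a ∩ C).Nonempty := by
        by_contra hcon
        rw [Set.not_nonempty_iff_eq_empty] at hcon
        rw [hcon, infEDist_empty] at h
        exact infEDist_ne_top (hS.nonempty a) (top_le_iff.1 h)
      obtain ⟨z, hz, hzq⟩ := ((hS.isCompact a).inter_right hC).exists_infEDist_eq_edist hne q
      exact ⟨z, ⟨hz.1, by simpa [← hzq] using h⟩, hz.2⟩

/-- Measurable compact-valued maps have measurable selections. -/
theorem MeasurableCompactValued.exists_measurable_selection [TopologicalSpace.SeparableSpace Z]
    [MeasurableSpace Z] [BorelSpace Z] {S : α → Set Z} (hS : MeasurableCompactValued S) :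
    ∃ s : α → Z, Measurable s ∧ ∀ a, s a ∈ S a := by
  rcases isEmpty_or_nonempty α with hα | ⟨⟨a₀⟩⟩
  · exact ⟨fun a => (hα.false a).elim, measurable_of_empty _, fun a => (hα.false a).elim⟩
  have : Nonempty Z := ⟨(hS.nonempty a₀).some⟩
  let q := TopologicalSpace.denseSeq Z
  -- Successively keep only the points nearest to `q 0`, `q 1`, and so on. The sets stay compact and
  -- non-empty, and shrink to a single point.
  let T : ℕ → α → Set Z := fun n => Nat.rec S (fun n A => _root_.nearestPoints (q n) A) n
  have hT : ∀ n, MeasurableCompactValued (T n) := by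
    intro n
    induction n with
    | zero => exact hS
    | succ n ih => exact ih.nearestPoints (q n)
  have hanti : ∀ n a, T (n + 1) a ⊆ T n a := fun n a => Set.inter_subset_left
  have hinter : ∀ C : Set Z, IsClosed C → ∀ a, (∀ n, (T n a ∩ C).Nonempty) →
      (⋂ n, T n a ∩ C).Nonempty := fun C hC a h =>
    IsCompact.nonempty_iInter_of_sequence_nonempty_isCompact_isClosed _
      (fun n => Set.inter_subset_inter_left _ (hanti n a)) h
      (((hT 0).isCompact a).inter_right hC)
      (fun n => (((hT n).isCompact a).inter_right hC).isClosed)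
  have hne : ∀ a, (⋂ n, T n a).Nonempty := fun a => by
    simpa using hinter Set.univ isClosed_univ a (fun n => by simpa using (hT n).nonempty a)
  -- Two surviving points are equidistant from every point of a dense sequence, hence equal.
  have huniq : ∀ a z z', z ∈ ⋂ n, T n a → z' ∈ ⋂ n, T n a → z = z' := by
    intro a z z' hz hz'
    rw [Set.mem_iInter] at hz hz'
    have hle : ∀ n z z', (∀ n, z ∈ T n a) → (∀ n, z' ∈ T n a) → edist (q n) z ≤ edist (q n) z' :=
      fun n z z' hz hz' => (hz (n + 1)).2.trans (infEDist_le_edist_of_mem (hz' n))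
    have heq : (fun w => edist w z) = fun w => edist w z' := by
      refine Continuous.ext_on (TopologicalSpace.denseRange_denseSeq Z) (by fun_prop)
        (by fun_prop) ?_
      rintro _ ⟨n, rfl⟩
      exact le_antisymm (hle n z z' hz hz') (hle n z' z hz' hz)
    have := congrFun heq z
    simpa using this.symm
  choose s hs using hne
  refine ⟨s, measurable_of_isClosed fun C hC => ?_, fun a => Set.mem_iInter.1 (hs a) 0⟩
  -- If every `T n a` meets `C`, compactness gives a common point in `C`, which by uniqueness is `s
  -- a`.
  have : s ⁻¹' C = ⋂ n, {a | (T n a ∩ C).Nonempty} := by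
    ext a
    simp only [Set.mem_preimage, Set.mem_iInter, Set.mem_ofPred_eq]
    constructor
    · exact fun h n => ⟨s a, Set.mem_iInter.1 (hs a) n, h⟩
    · intro h
      obtain ⟨z, hz⟩ := hinter C hC a h
      rw [Set.mem_iInter] at hz
      rw [huniq a (s a) z (hs a) (Set.mem_iInter.2 fun n => (hz n).1)]
      exact (hz 0).2
  rw [this]
  exact MeasurableSet.iInter fun n => (hT n).measurable_hit C hC

end Selection

/-! ### Images of bounded closed convex sets of Hilbert spaces -/

section Hilbert

open Filter Topology

variable {V W : Type*} [NormedAddCommGroup V] [InnerProductSpace ℝ V]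

/-- The midpoint of `u` and `v` lies in `A`, so its norm is at least `‖u‖`; insert this in the
parallelogram law. -/
theorem norm_sub_sq_le_of_forall_norm_le {A : Set V} (hA : Convex ℝ A) {u v : V} (hu : u ∈ A)
    (hmin : ∀ w ∈ A, ‖u‖ ≤ ‖w‖) (hv : v ∈ A) : ‖u - v‖ ^ 2 ≤ 2 * (‖v‖ ^ 2 - ‖u‖ ^ 2) := by
  have h1 := hmin _ (hA hu hv (by norm_num : (0 : ℝ) ≤ 1 / 2) (by norm_num : (0 : ℝ) ≤ 1 / 2)
    (by norm_num))
  rw [← smul_add, norm_smul, Real.norm_of_nonneg (by norm_num)] at h1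
  have h2 := parallelogram_law_with_norm ℝ u v
  nlinarith [norm_nonneg u, norm_nonneg (u + v)]

/-- A decreasing sequence of non-empty closed convex subsets of a bounded set of a Hilbert space
has non-empty intersection. -/
theorem nonempty_iInter_of_antitone_of_convex [CompleteSpace V] {A : ℕ → Set V} (hanti : Antitone A)
    (hne : ∀ n, (A n).Nonempty) (hclosed : ∀ n, IsClosed (A n)) (hconv : ∀ n, Convex ℝ (A n))
    {R : ℝ} (hR : ∀ v ∈ A 0, ‖v‖ ≤ R) : (⋂ n, A n).Nonempty := by
  -- The elements of minimal norm form a Cauchy sequence: their squared norms increase to a finite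
  -- limit `l` and control their mutual distances. The limit lies in every `A n`.
  have hex : ∀ n, ∃ u ∈ A n, ∀ w ∈ A n, ‖u‖ ≤ ‖w‖ := by
    intro n
    obtain ⟨u, hu, hinf⟩ :=
      exists_norm_eq_iInf_of_complete_convex (hne n) (hclosed n).isComplete (hconv n) 0
    refine ⟨u, hu, fun w hw => ?_⟩
    have h := ciInf_le (f := fun w : A n => ‖(0 : V) - w‖)
      ⟨0, Set.forall_mem_range.2 fun _ => norm_nonneg _⟩ ⟨w, hw⟩
    rw [← hinf] at h
    simpa using h
  choose u hu hmin using hex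
  have hmono : Monotone fun n => ‖u n‖ ^ 2 := fun n k hnk =>
    pow_le_pow_left₀ (norm_nonneg _) (hmin n _ (hanti hnk (hu k))) 2
  have hbdd : BddAbove (Set.range fun n => ‖u n‖ ^ 2) := by
    refine ⟨R ^ 2, Set.forall_mem_range.2 fun n => ?_⟩
    exact pow_le_pow_left₀ (norm_nonneg _) (hR _ (hanti (Nat.zero_le n) (hu n))) 2
  set l := ⨆ n, ‖u n‖ ^ 2
  have hlim : Tendsto (fun n => ‖u n‖ ^ 2) atTop (𝓝 l) := tendsto_atTop_ciSup hmono hbdd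
  have hcauchy : CauchySeq u := by
    refine cauchySeq_of_le_tendsto_0' (fun n => √(2 * (l - ‖u n‖ ^ 2))) (fun n k hnk => ?_) ?_
    · rw [dist_eq_norm]
      refine Real.le_sqrt_of_sq_le ?_
      have := norm_sub_sq_le_of_forall_norm_le (hconv n) (hu n) (hmin n) (hanti hnk (hu k))
      have : ‖u k‖ ^ 2 ≤ l := le_ciSup hbdd k
      linarith
    · have := ((hlim.const_sub l).const_mul 2).sqrt
      simpa using this
  obtain ⟨v, hv⟩ := cauchySeq_tendsto_of_complete hcauchy
  refine ⟨v, Set.mem_iInter.2 fun n => (hclosed n).mem_of_tendsto hv ?_⟩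
  filter_upwards [eventually_ge_atTop n] with k hk using hanti hk (hu k)

/-- Plays the role of weak compactness: for `p` in the closure of the image, the points of `C` sent
within `1 / (n + 1)` of `p` form a decreasing sequence of non-empty closed convex bounded sets. A
common point is sent to `p`. -/
theorem isClosed_image_of_convex_of_isBounded [CompleteSpace V] [NormedAddCommGroup W] [NormedSpace ℝ W]
    (T : V →L[ℝ] W) {C : Set V} (hC : IsClosed C) (hconv : Convex ℝ C)
    (hb : Bornology.IsBounded C) : IsClosed (T '' C) := by
  refine isClosed_of_closure_subset fun p hp => ?_
  obtain ⟨R, hR⟩ := isBounded_iff_forall_norm_le.1 hb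
  let A : ℕ → Set V := fun n => C ∩ T ⁻¹' Metric.closedBall p (1 / ((n : ℝ) + 1))
  obtain ⟨v, hv⟩ := nonempty_iInter_of_antitone_of_convex (A := A) (R := R)
    (fun n k hnk => Set.inter_subset_inter_right _ <| Set.preimage_mono <|
      Metric.closedBall_subset_closedBall (Nat.one_div_le_one_div hnk))
    (fun n => by
      obtain ⟨_, ⟨v, hv, rfl⟩, hd⟩ := Metric.mem_closure_iff.1 hp _ (Nat.one_div_pos_of_nat (n := n))
      exact ⟨v, hv, by simpa [dist_comm] using hd.le⟩)
    (fun n => hC.inter (Metric.isClosed_closedBall.preimage T.continuous))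
    (fun n => hconv.inter ((convex_closedBall _ _).linear_preimage T.toLinearMap))
    (fun v hv => hR v hv.1)
  rw [Set.mem_iInter] at hv
  refine ⟨v, (hv 0).1, ?_⟩
  rw [← dist_le_zero]
  exact ge_of_tendsto' tendsto_one_div_add_atTop_nhds_zero_nat fun n => (hv n).2

end Hilbert

/-! ### Allocations of a probability measure -/

section Allocation

variable {X ι : Type*} [MeasurableSpace X] [Fintype ι]

/-- The relaxed partitions of `X` indexed by `ι`. -/
structure IsAllocation (w : ι → X → ℝ) : Prop where
  measurable : ∀ i, Measurable (w i)
  nonneg : ∀ i x, 0 ≤ w i x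
  sum_eq_one : ∀ x, ∑ i, w i x = 1

theorem IsAllocation.le_one {w : ι → X → ℝ} (hw : IsAllocation w) (i : ι) (x : X) : w i x ≤ 1 := by
  rw [← hw.sum_eq_one x]
  exact Finset.single_le_sum (f := fun j => w j x) (fun j _ => hw.nonneg j x) (Finset.mem_univ i)

theorem IsAllocation.integrable_mul {w : ι → X → ℝ} (hw : IsAllocation w) {m : Measure X}
    {d : X → ℝ} (hd : Integrable d m) (i : ι) : Integrable (fun x => w i x * d x) m :=
  hd.bdd_mul (hw.measurable i).aestronglyMeasurable (c := 1)
    (Filter.Eventually.of_forall fun x => by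
      rw [Real.norm_of_nonneg (hw.nonneg i x)]; exact hw.le_one i x)

/-- The allocation associated with a partition. -/
def partitionAllocation [DecidableEq ι] (k : X → ι) (i : ι) (x : X) : ℝ := if k x = i then 1 else 0

theorem isAllocation_partitionAllocation [DecidableEq ι] [MeasurableSpace ι] [MeasurableSingletonClass ι]
    {k : X → ι} (hk : Measurable k) : IsAllocation (partitionAllocation k) where
  measurable i := Measurable.ite (hk (measurableSet_singleton i)) measurable_const measurable_const
  nonneg i x := by unfold partitionAllocation; split_ifs <;> norm_num
  sum_eq_one x := by simp [partitionAllocation]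

section L2

theorem coeFn_sum_Lp {κ : Type*} {m : Measure X} (s : Finset κ) (u : κ → Lp ℝ 2 m) :
    ⇑(∑ i ∈ s, u i) =ᵐ[m] ∑ i ∈ s, ⇑(u i) := by
  classical
  induction s using Finset.induction_on with
  | empty => simpa using Lp.coeFn_zero ℝ 2 m
  | insert i s hi ih =>
    rw [Finset.sum_insert hi, Finset.sum_insert hi]
    exact (Lp.coeFn_add _ _).trans (Filter.EventuallyEq.rfl.add ih)

variable (m : Measure X)

/-- The set of allocations in `L²`. -/
def allocationSet [IsFiniteMeasure m] : Set (PiLp 2 fun _ : ι => Lp ℝ 2 m) :=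
  {u | (∀ i, 0 ≤ u i) ∧ ∑ i, u i = (memLp_const (1 : ℝ)).toLp (fun _ => (1 : ℝ))}

variable [IsFiniteMeasure m]

theorem isClosed_allocationSet : IsClosed (allocationSet (ι := ι) m) := by
  have h1 : ∀ i, Continuous fun u : PiLp 2 fun _ : ι => Lp ℝ 2 m => u i :=
    fun i => (PiLp.proj (𝕜 := ℝ) 2 (fun _ : ι => Lp ℝ 2 m) i).continuous
  have h2 : IsClosed {u : PiLp 2 fun _ : ι => Lp ℝ 2 m | ∀ i, 0 ≤ u i} := by
    rw [Set.ofPred_forall]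
    exact isClosed_iInter fun i => isClosed_le continuous_const (h1 i)
  exact h2.inter (isClosed_eq (continuous_finsetSum _ fun i _ => h1 i) continuous_const)

theorem convex_allocationSet : Convex ℝ (allocationSet (ι := ι) m) := by
  rintro u ⟨hu1, hu2⟩ v ⟨hv1, hv2⟩ a b ha hb hab
  refine ⟨fun i => ?_, ?_⟩
  · have h1 : 0 ≤ a • u i := by
      rw [← Lp.coeFn_nonneg]
      filter_upwards [(Lp.coeFn_nonneg _).2 (hu1 i), Lp.coeFn_smul a (u i)] with x hx hx'
      rw [hx']
      exact mul_nonneg ha hx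
    have h2 : 0 ≤ b • v i := by
      rw [← Lp.coeFn_nonneg]
      filter_upwards [(Lp.coeFn_nonneg _).2 (hv1 i), Lp.coeFn_smul b (v i)] with x hx hx'
      rw [hx']
      exact mul_nonneg hb hx
    exact add_nonneg h1 h2
  · simp only [PiLp.add_apply, PiLp.smul_apply, Finset.sum_add_distrib, ← Finset.smul_sum, hu2, hv2]
    rw [← add_smul, hab, one_smul]

theorem isBounded_allocationSet : Bornology.IsBounded (allocationSet (ι := ι) m) := by
  set e : Lp ℝ 2 m := (memLp_const (1 : ℝ)).toLp (fun _ => (1 : ℝ))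
  refine isBounded_iff_forall_norm_le.2 ⟨√(∑ _i : ι, ‖e‖ ^ 2), ?_⟩
  rintro u ⟨hu1, hu2⟩
  rw [PiLp.norm_eq_of_L2]
  refine Real.sqrt_le_sqrt (Finset.sum_le_sum fun i _ => pow_le_pow_left₀ (norm_nonneg _) ?_ 2)
  have h : u i ≤ e := by
    refine le_of_le_of_eq ?_ hu2
    exact Finset.single_le_sum (f := fun j => u j) (fun j _ => hu1 j) (Finset.mem_univ i)
  refine norm_le_norm_of_abs_le_abs ?_
  rw [abs_of_nonneg (hu1 i), abs_of_nonneg ((hu1 i).trans h)]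
  exact h

variable {m}

theorem IsAllocation.memLp {w : ι → X → ℝ} (hw : IsAllocation w) (i : ι) : MemLp (w i) 2 m :=
  MemLp.of_bound (hw.measurable i).aestronglyMeasurable 1
    (Filter.Eventually.of_forall fun x => by
      rw [Real.norm_of_nonneg (hw.nonneg i x)]; exact hw.le_one i x)

theorem IsAllocation.toLp_mem {w : ι → X → ℝ} (hw : IsAllocation w) :
    WithLp.toLp 2 (fun i => (hw.memLp i).toLp (w i)) ∈ allocationSet m := by
  refine ⟨fun i => ?_, ?_⟩
  · rw [← Lp.coeFn_nonneg]
    filter_upwards [(hw.memLp (m := m) i).coeFn_toLp] with x hx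
    simp only [hx]
    exact hw.nonneg i x
  · refine Lp.ext ?_
    have h1 : ∀ᵐ x ∂m, ∀ i, (hw.memLp (m := m) i).toLp (w i) x = w i x :=
      ae_all_iff.2 fun i => (hw.memLp i).coeFn_toLp
    filter_upwards [h1, (memLp_const (1 : ℝ)).coeFn_toLp (p := 2) (μ := m),
      coeFn_sum_Lp Finset.univ (fun i => (hw.memLp (m := m) i).toLp (w i))] with x hx1 hx2 hx3
    rw [hx2, hx3, Finset.sum_apply]
    simp only [hx1, hw.sum_eq_one]

/-- The constraints hold only almost everywhere for the representatives; on the exceptional null set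
all the weight is given to one fixed index. -/
theorem exists_isAllocation_of_mem [Nonempty ι] {u : PiLp 2 fun _ : ι => Lp ℝ 2 m}
    (hu : u ∈ allocationSet m) : ∃ w : ι → X → ℝ, IsAllocation w ∧ ∀ i, w i =ᵐ[m] u i := by
  obtain ⟨hu1, hu2⟩ := hu
  let G : Set X := {x | (∀ i, 0 ≤ u i x) ∧ ∑ i, u i x = 1}
  have hmeas : ∀ i, Measurable (u i) := fun i => (Lp.stronglyMeasurable (u i)).measurable
  have hG : MeasurableSet G := by
    refine MeasurableSet.inter ?_ ?_
    · change MeasurableSet {x | ∀ i, 0 ≤ u i x}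
      rw [Set.ofPred_forall]
      exact MeasurableSet.iInter fun i => measurableSet_le measurable_const (hmeas i)
    · exact measurableSet_eq_fun (by fun_prop) measurable_const
  have hGae : ∀ᵐ x ∂m, x ∈ G := by
    have h1 : ∀ᵐ x ∂m, ∀ i, 0 ≤ u i x := ae_all_iff.2 fun i => (Lp.coeFn_nonneg _).2 (hu1 i)
    filter_upwards [h1, (memLp_const (1 : ℝ)).coeFn_toLp (p := 2) (μ := m),
      coeFn_sum_Lp Finset.univ (fun i => u i)] with x hx1 hx2 hx3
    refine ⟨hx1, ?_⟩
    rw [hu2, hx2, Finset.sum_apply] at hx3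
    exact hx3.symm
  let i₀ : ι := Classical.arbitrary ι
  classical
  refine ⟨fun i x => if x ∈ G then u i x else if i₀ = i then 1 else 0, ⟨fun i => ?_, fun i x => ?_,
    fun x => ?_⟩, fun i => ?_⟩
  · exact Measurable.ite hG (hmeas i) measurable_const
  · dsimp only
    split_ifs with h1 h2
    exacts [h1.1 i, zero_le_one, le_rfl]
  · by_cases hx : x ∈ G
    · simpa [hx] using hx.2
    · simp [hx]
  · filter_upwards [hGae] with x hx
    simp [hx]

end L2

end Allocation

/-! ### Duality for allocations with prescribed masses -/

section AllocationDuality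

variable {X ι : Type*} [Fintype ι]

/-- The density `1 + ∑ᵢ dᵢ`. -/
def costWeight (d : ι → X → ℝ) (x : X) : ℝ := 1 + ∑ i, d i x

theorem one_le_costWeight {d : ι → X → ℝ} (hd0 : ∀ i x, 0 ≤ d i x) (x : X) : 1 ≤ costWeight d x :=
  le_add_of_nonneg_right (Finset.sum_nonneg fun i _ => hd0 i x)

variable [MeasurableSpace X]

/-- The measure with density `1 + ∑ᵢ dᵢ`, for which the transport cost is a continuous functional
on `L²`. -/
noncomputable def weightedMeasure (d : ι → X → ℝ) (m : Measure X) : Measure X :=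
  m.withDensity fun x => ENNReal.ofReal (costWeight d x)

variable {d : ι → X → ℝ} {m : Measure X}

theorem measurable_costWeight (hdm : ∀ i, Measurable (d i)) : Measurable (costWeight d) := by
  unfold costWeight
  fun_prop

theorem isFiniteMeasure_weightedMeasure [IsFiniteMeasure m] (hdi : ∀ i, Integrable (d i) m) :
    IsFiniteMeasure (weightedMeasure d m) :=
  isFiniteMeasure_withDensity_ofReal
    ((integrable_const 1).add (integrable_finsetSum _ fun i _ => hdi i)).2

theorem absolutelyContinuous_weightedMeasure (hd0 : ∀ i x, 0 ≤ d i x)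
    (hdm : ∀ i, Measurable (d i)) : m ≪ weightedMeasure d m := by
  refine withDensity_absolutelyContinuous' (measurable_costWeight hdm).ennreal_ofReal.aemeasurable
    (Filter.Eventually.of_forall fun x => ?_)
  simpa using lt_of_lt_of_le zero_lt_one (one_le_costWeight hd0 x)

/-- The costs `d i` are integrable for `m` but need not be square integrable. After division by the
density, both `1` and `d i` are bounded by one, so masses and costs become inner products in `L²` of
the weighted measure. -/
theorem memLp_div_costWeight [IsFiniteMeasure (weightedMeasure d m)] (hd0 : ∀ i x, 0 ≤ d i x)
    (hdm : ∀ i, Measurable (d i)) {h : X → ℝ} (hm : Measurable h) (h0 : ∀ x, 0 ≤ h x)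
    (h1 : ∀ x, h x ≤ costWeight d x) :
    MemLp (fun x => h x / costWeight d x) 2 (weightedMeasure d m) := by
  refine MemLp.of_bound (hm.div (measurable_costWeight hdm)).aestronglyMeasurable 1
    (Filter.Eventually.of_forall fun x => ?_)
  have hq := lt_of_lt_of_le zero_lt_one (one_le_costWeight hd0 x)
  rw [Real.norm_of_nonneg (div_nonneg (h0 x) hq.le), div_le_one hq]
  exact h1 x

theorem inner_toLp_div_costWeight [IsFiniteMeasure (weightedMeasure d m)]
    (hd0 : ∀ i x, 0 ≤ d i x) (hdm : ∀ i, Measurable (d i)) {h : X → ℝ}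
    (hh : MemLp (fun x => h x / costWeight d x) 2 (weightedMeasure d m))
    {v : Lp ℝ 2 (weightedMeasure d m)} {w : X → ℝ} (hv : w =ᵐ[weightedMeasure d m] v) :
    inner ℝ (hh.toLp _) v = ∫ x, w x * h x ∂m := by
  rw [L2.inner_def]
  have h1 : (fun x => inner ℝ (hh.toLp _ x) (v x)) =ᵐ[weightedMeasure d m]
      fun x => w x * (h x / costWeight d x) := by
    filter_upwards [hv, hh.coeFn_toLp] with x hx1 hx2
    simp [hx1, hx2]
  rw [integral_congr_ae h1, weightedMeasure, integral_withDensity_eq_integral_toReal_smul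
    (measurable_costWeight hdm).ennreal_ofReal (by simp)]
  refine integral_congr_ae (Filter.Eventually.of_forall fun x => ?_)
  have hq := lt_of_lt_of_le zero_lt_one (one_le_costWeight hd0 x)
  simp only [ENNReal.toReal_ofReal hq.le, smul_eq_mul]
  field_simp

theorem exists_continuousLinearMap_allocation [IsFiniteMeasure (weightedMeasure d m)]
    (hd0 : ∀ i x, 0 ≤ d i x) (hdm : ∀ i, Measurable (d i)) :
    ∃ T : (PiLp 2 fun _ : ι => Lp ℝ 2 (weightedMeasure d m)) →L[ℝ] (ι → ℝ) × ℝ,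
      ∀ u (w : ι → X → ℝ), (∀ i, w i =ᵐ[weightedMeasure d m] u i) →
        T u = (fun i => ∫ x, w i x ∂m, ∑ i, ∫ x, w i x * d i x ∂m) := by
  have hone := memLp_div_costWeight (m := m) hd0 hdm (measurable_const (a := (1 : ℝ)))
    (fun _ => zero_le_one) (one_le_costWeight hd0)
  have hdL := fun i => memLp_div_costWeight (m := m) hd0 hdm (hdm i) (hd0 i) fun x =>
    (Finset.single_le_sum (f := fun j => d j x) (fun j _ => hd0 j x) (Finset.mem_univ i)).trans
      (le_add_of_nonneg_left zero_le_one)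
  refine ⟨ContinuousLinearMap.prod
    (ContinuousLinearMap.pi fun i => (innerSL ℝ (hone.toLp _)).comp
      (PiLp.proj (𝕜 := ℝ) 2 (fun _ : ι => Lp ℝ 2 (weightedMeasure d m)) i))
    (∑ i, (innerSL ℝ ((hdL i).toLp _)).comp
      (PiLp.proj (𝕜 := ℝ) 2 (fun _ : ι => Lp ℝ 2 (weightedMeasure d m)) i)), fun u w h => ?_⟩
  refine Prod.ext (funext fun i => ?_) ?_
  · have := inner_toLp_div_costWeight hd0 hdm hone (h i)
    simpa using this
  · simp only [ContinuousLinearMap.prod_apply, sum_apply,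
      ContinuousLinearMap.comp_apply, innerSL_apply_apply, PiLp.proj_apply]
    exact Finset.sum_congr rfl fun i _ => inner_toLp_div_costWeight hd0 hdm (hdL i) (h i)

theorem apply_eq_sum_add (φ : StrongDual ℝ ((ι → ℝ) × ℝ)) [DecidableEq ι] (a : ι → ℝ) (c : ℝ) :
    φ (a, c) = ∑ i, a i * φ (Pi.single i 1, 0) + c * φ (0, 1) := by
  have h : (a, c) = ∑ i, a i • ((Pi.single i 1, 0) : (ι → ℝ) × ℝ) + c • ((0, 1) : (ι → ℝ) × ℝ) := by
    refine Prod.ext (funext fun j => ?_) ?_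
    · simp [Prod.fst_sum, Finset.sum_apply, Pi.single_apply]
    · simp [Prod.snd_sum]
  conv_lhs => rw [h]
  simp only [map_add, map_sum, map_smul, smul_eq_mul]

theorem sum_integral_partitionAllocation_mul [DecidableEq ι] [MeasurableSpace ι]
    [MeasurableSingletonClass ι] {k : X → ι} (hk : Measurable k) {e : ι → X → ℝ}
    (he : ∀ i, Integrable (e i) m) :
    ∑ i, ∫ x, partitionAllocation k i x * e i x ∂m = ∫ x, e (k x) x ∂m := by
  rw [← integral_finsetSum _ fun i _ =>
    (isAllocation_partitionAllocation hk).integrable_mul (he i) i]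
  simp [partitionAllocation]

/-- Duality for allocation problems: allocations with prescribed masses and cost at most `c`
exist if the corresponding bound holds for the dual problem. -/
theorem exists_isAllocation_of_forall_partition [Nonempty ι] [MeasurableSpace ι]
    [MeasurableSingletonClass ι] [IsProbabilityMeasure m] (hd0 : ∀ i x, 0 ≤ d i x)
    (hdm : ∀ i, Measurable (d i)) (hdi : ∀ i, Integrable (d i) m) {a : ι → ℝ} {c : ℝ}
    (ha0 : ∀ i, 0 ≤ a i) (ha1 : ∑ i, a i = 1)
    (h : ∀ ψ : ι → ℝ, ∃ k : X → ι, Measurable k ∧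
      ∫ x, (ψ (k x) + d (k x) x) ∂m ≤ ∑ i, a i * ψ i + c) :
    ∃ w : ι → X → ℝ, IsAllocation w ∧ (∀ i, ∫ x, w i x ∂m = a i) ∧
      ∑ i, ∫ x, w i x * d i x ∂m ≤ c := by
  classical
  have hfin := isFiniteMeasure_weightedMeasure hdi
  have hac := absolutelyContinuous_weightedMeasure (m := m) hd0 hdm
  obtain ⟨T, hT⟩ := exists_continuousLinearMap_allocation (m := m) hd0 hdm
  set W := allocationSet (ι := ι) (weightedMeasure d m)
  let B : Set ((ι → ℝ) × ℝ) := {p | p.1 = a ∧ p.2 ≤ c}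
  by_cases hdisj : Disjoint (T '' W) B
  swap
  · obtain ⟨_, ⟨u, hu, rfl⟩, hB1, hB2⟩ := Set.not_disjoint_iff.1 hdisj
    obtain ⟨w, hw, hwu⟩ := exists_isAllocation_of_mem hu
    rw [hT u w hwu] at hB1 hB2
    exact ⟨w, hw, fun i => congrFun hB1 i, hB2⟩
  exfalso
  have hBc : IsClosed B := (isClosed_eq continuous_fst continuous_const).inter
    (isClosed_le continuous_snd continuous_const)
  have hBconv : Convex ℝ B := by
    have : B = {a} ×ˢ Set.Iic c := by ext p; simp [B]
    rw [this]
    exact (convex_singleton a).prod (convex_Iic c)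
  have hbdd := isBounded_allocationSet (ι := ι) (weightedMeasure d m)
  have hconv := convex_allocationSet (ι := ι) (weightedMeasure d m)
  -- The attainable pairs (masses, cost) form a compact convex set of a finite-dimensional space. If
  -- it misses the half-line `B`, the two are strictly separated.
  have hcomp : IsCompact (T '' W) := Metric.isCompact_of_isClosed_isBounded
    (isClosed_image_of_convex_of_isBounded T (isClosed_allocationSet _) hconv hbdd)
    (T.lipschitz.isBounded_image hbdd)
  obtain ⟨φ, s, t, hs, hst, ht⟩ := geometric_hahn_banach_compact_closed
    (hconv.linear_image T.toLinearMap) hcomp hBconv hBc hdisj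
  set α : ι → ℝ := fun i => φ (Pi.single i 1, 0)
  set β : ℝ := φ (0, 1)
  have hpart : ∀ k : X → ι, Measurable k → ∫ x, (α (k x) + β * d (k x) x) ∂m < s := by
    intro k hk
    have hw := isAllocation_partitionAllocation hk
    have h1 := hs _ (Set.mem_image_of_mem T (hw.toLp_mem (m := weightedMeasure d m)))
    rw [hT _ (partitionAllocation k) (fun i => (hw.memLp i).coeFn_toLp.symm),
      apply_eq_sum_add] at h1
    refine lt_of_eq_of_lt ?_ h1
    rw [← sum_integral_partitionAllocation_mul hk (e := fun i x => α i + β * d i x)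
      (fun i => (integrable_const _).add ((hdi i).const_mul β)), Finset.sum_mul,
      ← Finset.sum_add_distrib]
    refine Finset.sum_congr rfl fun i _ => ?_
    have h2 : Integrable (partitionAllocation k i) m := by
      simpa using hw.integrable_mul (integrable_const (1 : ℝ)) i
    rw [← integral_mul_const, ← integral_mul_const, ← integral_add (h2.mul_const _)
      ((hw.integrable_mul (hdi i) i).mul_const _)]
    exact integral_congr_ae (Filter.Eventually.of_forall fun x => by ring)
  have hB : ∀ c' ≤ c, t < ∑ i, a i * α i + c' * β := fun c' hc' => by
    have := ht (a, c') ⟨rfl, hc'⟩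
    rwa [apply_eq_sum_add] at this
  -- The half-line `B` is unbounded below in the cost. With `β > 0`, the cost `(t - r) / β` or less
  -- would push the functional down to `t`.
  have hβ : β ≤ 0 := by
    by_contra! hpos
    set r := ∑ i, a i * α i
    have h1 := hB (min c ((t - r) / β)) (min_le_left _ _)
    have h2 : min c ((t - r) / β) * β ≤ (t - r) / β * β :=
      mul_le_mul_of_nonneg_right (min_le_right _ _) hpos.le
    rw [div_mul_cancel₀ _ hpos.ne'] at h2
    linarith
  -- For `β < 0`, dividing by `β` turns the functional into a dual potential `α / β`, and the
  -- hypothesis contradicts the separation. For `β = 0` the masses alone would be separated, which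
  -- fails when everything is assigned to an index maximizing `α`, as `a` is a probability vector.
  rcases hβ.lt_or_eq with hneg | hzero
  · obtain ⟨k, hk, hle⟩ := h fun i => α i / β
    have h1 := hpart k hk
    have h2 := hB c le_rfl
    have h3 : ∫ x, (α (k x) + β * d (k x) x) ∂m = β * ∫ x, (α (k x) / β + d (k x) x) ∂m := by
      rw [← integral_const_mul]
      refine integral_congr_ae (Filter.Eventually.of_forall fun x => ?_)
      have := hneg.ne
      field_simp
    have h4 : β * (∑ i, a i * (α i / β) + c) = ∑ i, a i * α i + c * β := by
      rw [mul_add, Finset.mul_sum, mul_comm β c]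
      congr 1
      refine Finset.sum_congr rfl fun i _ => ?_
      have := hneg.ne
      field_simp
    have h5 := mul_le_mul_of_nonpos_left hle hneg.le
    linarith
  · obtain ⟨i₀, -, hi₀⟩ := Finset.exists_max_image Finset.univ α Finset.univ_nonempty
    have h1 := hpart (fun _ => i₀) measurable_const
    have h2 := hB c le_rfl
    have h3 : ∑ i, a i * α i ≤ ∑ i, a i * α i₀ := Finset.sum_le_sum fun i hi =>
      mul_le_mul_of_nonneg_left (hi₀ i hi) (ha0 i)
    rw [← Finset.sum_mul, ha1, one_mul] at h3
    simp only [hzero, zero_mul, mul_zero, add_zero, integral_const, probReal_univ,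
      one_smul] at h1 h2
    linarith

end AllocationDuality

/-! ### The Kantorovich–Rubinstein distance to an empirical distribution -/

section MeasurableArgmin

theorem exists_measurable_argmin {X : Type*} [MeasurableSpace X] {N : ℕ} [NeZero N]
    {e : Fin N → X → ℝ} (he : ∀ i, Measurable (e i)) :
    ∃ k : X → Fin N, Measurable k ∧ ∀ x j, e (k x) x ≤ e j x := by
  classical
  let S : X → Finset (Fin N) := fun x => Finset.univ.filter fun i => ∀ j, e i x ≤ e j x
  have hS : ∀ x, (S x).Nonempty := fun x => by
    obtain ⟨i, -, hi⟩ := Finset.exists_min_image Finset.univ (fun i => e i x) Finset.univ_nonempty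
    exact ⟨i, by simpa [S] using hi⟩
  have hmem : ∀ i, MeasurableSet {x | i ∈ S x} := fun i => by
    simp only [S, Finset.mem_filter, Finset.mem_univ, true_and, Set.ofPred_forall]
    exact MeasurableSet.iInter fun j => measurableSet_le (he i) (he j)
  -- Ties are broken by the least index, so each level set is a finite Boolean combination of the
  -- measurable sets `{x | j ∈ S x}`.
  refine ⟨fun x => (S x).min' (hS x), measurable_to_countable' fun i => ?_, fun x => ?_⟩
  · have : (fun x => (S x).min' (hS x)) ⁻¹' {i} =
        {x | i ∈ S x} ∩ ⋂ j : {j // j < i}, {x | j.1 ∈ S x}ᶜ := by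
      ext x
      simp only [Set.mem_preimage, Set.mem_singleton_iff, Set.mem_inter_iff, Set.mem_ofPred_eq,
        Set.mem_iInter, Set.mem_compl_iff, Subtype.forall]
      rw [Finset.min'_eq_iff]
      exact and_congr_right fun _ => ⟨fun h j hj hjS => (h j hjS).not_gt hj,
        fun h j hjS => not_lt.1 fun hj => h j hj hjS⟩
    rw [this]
    exact (hmem i).inter (MeasurableSet.iInter fun j => (hmem j).compl)
  · simpa [S] using (S x).min'_mem (hS x)

end MeasurableArgmin

namespace MFO

/-! ### Empirical distributions and couplings built from allocations -/

section Empirical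

variable {A : Type*} [MeasurableSpace A]

theorem lintegral_empirical {N : ℕ} (p : Fin N → A) {h : A → ℝ≥0∞} (hh : Measurable h) :
    ∫⁻ a, h a ∂(empirical p) = (N : ℝ≥0∞)⁻¹ * ∑ i, h (p i) := by
  simp [empirical, lintegral_smul_measure, lintegral_dirac' _ hh]

theorem integral_empirical {N : ℕ} [NeZero N] (p : Fin N → A) {E : Type*} [NormedAddCommGroup E]
    [NormedSpace ℝ E] [CompleteSpace E] {φ : A → E} (hφ : StronglyMeasurable φ) :
    ∫ a, φ a ∂(empirical p) = (N : ℝ)⁻¹ • ∑ i, φ (p i) := by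
  rw [empirical, integral_smul_measure, integral_finsetSum_measure]
  · simp [integral_dirac' _ _ hφ]
  · exact fun i _ => integrable_dirac' hφ (by simp)

end Empirical

section AllocationMeasure

variable {A B : Type*} [MeasurableSpace A] [MeasurableSpace B] {N : ℕ}

/-- The measure `∑ᵢ δ_{zᵢ} ⊗ (wᵢ m)`. -/
noncomputable def allocationMeasure (z : Fin N → A) (w : Fin N → B → ℝ) (m : Measure B) :
    Measure (A × B) :=
  ∑ i, (Measure.dirac (z i)).prod (m.withDensity fun b => ENNReal.ofReal (w i b))

variable {z : Fin N → A} {w : Fin N → B → ℝ} {m : Measure B}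

theorem lintegral_sum_allocation_mul (hw : IsAllocation w) {h : B → ℝ≥0∞} (hh : Measurable h) :
    ∑ i, ∫⁻ b, ENNReal.ofReal (w i b) * h b ∂m = ∫⁻ b, h b ∂m := by
  rw [← lintegral_finsetSum Finset.univ (f := fun i b => ENNReal.ofReal (w i b) * h b)
    fun i _ => (hw.measurable i).ennreal_ofReal.mul hh]
  refine lintegral_congr fun b => ?_
  rw [← Finset.sum_mul, ← ENNReal.ofReal_sum_of_nonneg fun i _ => hw.nonneg i b, hw.sum_eq_one]
  simp

variable [SFinite m]

theorem lintegral_allocationMeasure (hw : IsAllocation w) {h : A × B → ℝ≥0∞} (hh : Measurable h) :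
    ∫⁻ p, h p ∂(allocationMeasure z w m) =
      ∑ i, ∫⁻ b, ENNReal.ofReal (w i b) * h (z i, b) ∂m := by
  rw [allocationMeasure, lintegral_finsetSum_measure]
  refine Finset.sum_congr rfl fun i _ => ?_
  rw [lintegral_prod _ hh.aemeasurable, lintegral_dirac' _ hh.lintegral_prod_right',
    lintegral_withDensity_eq_lintegral_mul _ (hw.measurable i).ennreal_ofReal (by fun_prop)]
  rfl

theorem map_snd_allocationMeasure (hw : IsAllocation w) :
    (allocationMeasure z w m).map Prod.snd = m := by
  refine Measure.ext_of_lintegral _ fun h hh => ?_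
  rw [lintegral_map hh measurable_snd, lintegral_allocationMeasure hw (by fun_prop),
    lintegral_sum_allocation_mul hw hh]

theorem map_fst_allocationMeasure [IsFiniteMeasure m] (hw : IsAllocation w)
    (hmass : ∀ i, ∫ b, w i b ∂m = (N : ℝ)⁻¹) :
    (allocationMeasure z w m).map Prod.fst = empirical z := by
  have h1 : ∀ i, ∫⁻ b, ENNReal.ofReal (w i b) ∂m = (N : ℝ≥0∞)⁻¹ := fun i => by
    have hN : 0 < (N : ℝ) := Nat.cast_pos.2 i.pos
    have hi : Integrable (w i) m := by
      simpa using hw.integrable_mul (integrable_const (1 : ℝ)) i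
    rw [← ofReal_integral_eq_lintegral_ofReal hi (Filter.Eventually.of_forall (hw.nonneg i)),
      hmass, ENNReal.ofReal_inv_of_pos hN, ENNReal.ofReal_natCast]
  refine Measure.ext_of_lintegral _ fun h hh => ?_
  rw [lintegral_map hh measurable_fst, lintegral_allocationMeasure hw (by fun_prop),
    lintegral_empirical z hh, Finset.mul_sum]
  refine Finset.sum_congr rfl fun i _ => ?_
  dsimp only
  rw [lintegral_mul_const _ (hw.measurable i).ennreal_ofReal, h1]

/-- Applied to the projection of `Z` on `X`: the same weights with atoms in `Z` glue the input
measure to the plan with atoms in `X`. -/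
theorem map_prodMap_allocationMeasure {A' : Type*} [MeasurableSpace A'] (hw : IsAllocation w)
    {h : A → A'} (hh : Measurable h) :
    (allocationMeasure z w m).map (fun p => (h p.1, p.2)) = allocationMeasure (h ∘ z) w m := by
  refine Measure.ext_of_lintegral _ fun k hk => ?_
  rw [lintegral_map hk (by fun_prop), lintegral_allocationMeasure hw (by fun_prop),
    lintegral_allocationMeasure hw hk]
  rfl

theorem isProbabilityMeasure_allocationMeasure [IsProbabilityMeasure m] (hw : IsAllocation w) :
    IsProbabilityMeasure (allocationMeasure z w m) := by
  refine ⟨?_⟩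
  have h := congrArg (fun μ => μ Set.univ) (map_snd_allocationMeasure (z := z) (m := m) hw)
  rw [Measure.map_apply measurable_snd MeasurableSet.univ] at h
  simpa using h

end AllocationMeasure

/-! ### Semi-discrete Kantorovich–Rubinstein duality -/

section Transport

variable {X : Type*} [MetricSpace X] [MeasurableSpace X] [BorelSpace X]
  {m : Measure X} [IsProbabilityMeasure m] {N : ℕ}

theorem HasFirstMoment.integrable_of_lipschitzWith (hm : HasFirstMoment m) {φ : X → ℝ}
    (hφ : LipschitzWith 1 φ) : Integrable φ m := by
  obtain ⟨x₀, hx₀⟩ := hm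
  refine Integrable.mono' (hx₀.add (integrable_const |φ x₀|))
    hφ.continuous.measurable.aestronglyMeasurable (Filter.Eventually.of_forall fun x => ?_)
  have h := hφ.dist_le_mul x x₀
  rw [Real.dist_eq, NNReal.coe_one, one_mul] at h
  have h2 := abs_sub_abs_le_abs_sub (φ x) (φ x₀)
  simp only [Pi.add_apply, Real.norm_eq_abs]
  linarith

theorem HasFirstMoment.integrable_dist (hm : HasFirstMoment m) (x₀ : X) :
    Integrable (fun x => dist x₀ x) m :=
  hm.integrable_of_lipschitzWith (LipschitzWith.dist_right x₀)

theorem sum_lintegral_allocation_mul_edist (hm : HasFirstMoment m) (p : Fin N → X)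
    {w : Fin N → X → ℝ} (hw : IsAllocation w) :
    ∑ i, ∫⁻ x, ENNReal.ofReal (w i x) * edist (p i) x ∂m =
      ENNReal.ofReal (∑ i, ∫ x, w i x * dist (p i) x ∂m) := by
  have h0 : ∀ i x, 0 ≤ w i x * dist (p i) x := fun i x => mul_nonneg (hw.nonneg i x) dist_nonneg
  rw [ENNReal.ofReal_sum_of_nonneg fun i _ => integral_nonneg (h0 i)]
  refine Finset.sum_congr rfl fun i _ => ?_
  rw [ofReal_integral_eq_lintegral_ofReal (hw.integrable_mul (hm.integrable_dist (p i)) i)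
    (Filter.Eventually.of_forall (h0 i))]
  exact lintegral_congr fun x => by rw [ENNReal.ofReal_mul (hw.nonneg i x), edist_dist]

/-- Allocations whose cost is at most the Kantorovich–Rubinstein distance. -/
structure IsOptimalAllocation (m : Measure X) (p : Fin N → X) (w : Fin N → X → ℝ) : Prop where
  isAllocation : IsAllocation w
  mass : ∀ i, ∫ x, w i x ∂m = (N : ℝ)⁻¹
  cost_le : ∑ i, ∫⁻ x, ENNReal.ofReal (w i x) * edist (p i) x ∂m ≤
    ENNReal.ofReal (d1 (empirical p) m)

variable [NeZero N]

/-- A bound uniform in `φ`, which makes `d1` a genuine supremum rather than the default value `0` of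
an unbounded one. -/
theorem integral_empirical_sub_le (hm : HasFirstMoment m) (p : Fin N → X) {φ : X → ℝ}
    (hφ : LipschitzWith 1 φ) : ∫ x, φ x ∂(empirical p) - ∫ x, φ x ∂m ≤
      (N : ℝ)⁻¹ * ∑ i, ∫ x, dist (p i) x ∂m := by
  have hN : (N : ℝ) ≠ 0 := Nat.cast_ne_zero.2 (NeZero.ne N)
  have hint := hm.integrable_of_lipschitzWith hφ
  rw [integral_empirical p hφ.continuous.measurable.stronglyMeasurable]
  have h1 : ∀ i, φ (p i) - ∫ x, φ x ∂m ≤ ∫ x, dist (p i) x ∂m := fun i => by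
    have : φ (p i) - ∫ x, φ x ∂m = ∫ x, (φ (p i) - φ x) ∂m := by
      rw [integral_sub (integrable_const _) hint]; simp
    rw [this]
    refine integral_mono ((integrable_const _).sub hint) (hm.integrable_dist _) fun x => ?_
    have h := hφ.dist_le_mul (p i) x
    rw [Real.dist_eq, NNReal.coe_one, one_mul] at h
    exact (le_abs_self _).trans h
  have h2 : (N : ℝ)⁻¹ • ∑ i, φ (p i) - ∫ x, φ x ∂m =
      (N : ℝ)⁻¹ * ∑ i, (φ (p i) - ∫ x, φ x ∂m) := by
    rw [Finset.sum_sub_distrib]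
    simp [mul_sub, hN]
  rw [h2]
  exact mul_le_mul_of_nonneg_left (Finset.sum_le_sum fun i _ => h1 i) (by positivity)

theorem bddAbove_d1 (hm : HasFirstMoment m) (p : Fin N → X) :
    BddAbove (Set.range fun φ : {φ : X → ℝ // LipschitzWith 1 φ} =>
      (∫ x, φ.1 x ∂(empirical p)) - ∫ x, φ.1 x ∂m) :=
  ⟨_, Set.forall_mem_range.2 fun φ => integral_empirical_sub_le hm p φ.2⟩

theorem integral_sub_le_d1 (hm : HasFirstMoment m) (p : Fin N → X) {φ : X → ℝ}
    (hφ : LipschitzWith 1 φ) :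
    ∫ x, φ x ∂(empirical p) - ∫ x, φ x ∂m ≤ d1 (empirical p) m :=
  le_ciSup (bddAbove_d1 hm p) ⟨φ, hφ⟩

theorem d1_nonneg (hm : HasFirstMoment m) (p : Fin N → X) : 0 ≤ d1 (empirical p) m := by
  simpa using integral_sub_le_d1 hm p (LipschitzWith.const' (0 : ℝ) (K := 1))

/-- Semi-discrete Kantorovich–Rubinstein duality. -/
theorem exists_isAllocation_cost_le_d1 (hm : HasFirstMoment m) (p : Fin N → X) :
    ∃ w : Fin N → X → ℝ, IsAllocation w ∧ (∀ i, ∫ x, w i x ∂m = (N : ℝ)⁻¹) ∧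
      ∑ i, ∫ x, w i x * dist (p i) x ∂m ≤ d1 (empirical p) m := by
  have hN : (N : ℝ) ≠ 0 := Nat.cast_ne_zero.2 (NeZero.ne N)
  refine exists_isAllocation_of_forall_partition (fun i x => dist_nonneg) (fun i => by fun_prop)
    (fun i => hm.integrable_dist (p i)) (fun i => by positivity) (by simp [hN]) fun ψ => ?_
  obtain ⟨k, hk, hmin⟩ := exists_measurable_argmin (e := fun i x => ψ i + dist (p i) x)
    (fun i => by fun_prop)
  refine ⟨k, hk, ?_⟩
  -- Here `φ x` is the minimum over `i` of `ψ i + dist (p i) x`: it is 1-Lipschitz and `φ (p i) ≤ ψ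
  -- i`. Testing `d1` with `-φ` gives the dual bound.
  set φ : X → ℝ := fun x => ψ (k x) + dist (p (k x)) x with hφdef
  have hφ : LipschitzWith 1 φ := by
    refine LipschitzWith.of_le_add fun x y => ?_
    have h1 := hmin x (k y)
    have h2 := dist_triangle (p (k y)) y x
    rw [dist_comm y x] at h2
    simp only [hφdef]
    linarith
  have h1 := integral_sub_le_d1 hm p hφ.neg
  simp only [Pi.neg_apply, integral_neg] at h1
  rw [integral_empirical p hφ.continuous.measurable.stronglyMeasurable, smul_eq_mul,
    Finset.mul_sum] at h1
  have h2 : ∑ i, (N : ℝ)⁻¹ * φ (p i) ≤ ∑ i, (N : ℝ)⁻¹ * ψ i :=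
    Finset.sum_le_sum fun i _ => mul_le_mul_of_nonneg_left
      (by simpa using hmin (p i) i) (by positivity)
  linarith

theorem exists_isOptimalAllocation (hm : HasFirstMoment m) (p : Fin N → X) :
    ∃ w : Fin N → X → ℝ, IsOptimalAllocation m p w := by
  obtain ⟨w, hw, hmass, hcost⟩ := exists_isAllocation_cost_le_d1 hm p
  exact ⟨w, hw, hmass, by
    rw [sum_lintegral_allocation_mul_edist hm p hw]
    exact ENNReal.ofReal_le_ofReal hcost⟩

variable [SecondCountableTopology X]

theorem IsOptimalAllocation.transportCost_le {p : Fin N → X} {w : Fin N → X → ℝ}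
    (hw : IsOptimalAllocation m p w) :
    transportCost (allocationMeasure p w m) ≤ ENNReal.ofReal (d1 (empirical p) m) := by
  rw [transportCost, lintegral_allocationMeasure hw.isAllocation (by fun_prop)]
  exact hw.cost_le

/-- The easy half of duality: integrate `φ x - φ x' ≤ dist x x'` against the plan. A plan of
infinite cost is set apart, so that the distance is integrable. -/
theorem d1_le_transportCost (hm : HasFirstMoment m) (p : Fin N → X) {ρ : Measure (X × X)}
    (hρ : ρ ∈ plans (empirical p) m) :
    ENNReal.ofReal (d1 (empirical p) m) ≤ transportCost ρ := by
  obtain ⟨hprob, h1, h2⟩ := hρ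
  rcases eq_or_ne (transportCost ρ) ⊤ with htop | htop
  · simp [htop]
  have hdist : Integrable (fun q : X × X => dist q.1 q.2) ρ := by
    refine ⟨(by fun_prop : Measurable fun q : X × X => dist q.1 q.2).aestronglyMeasurable, ?_⟩
    rw [hasFiniteIntegral_iff_ofReal (Filter.Eventually.of_forall fun _ => dist_nonneg)]
    simp only [← edist_dist]
    exact lt_top_iff_ne_top.2 htop
  have hcost : (transportCost ρ).toReal = ∫ q, dist q.1 q.2 ∂ρ := by
    rw [integral_eq_lintegral_of_nonneg_ae (Filter.Eventually.of_forall fun _ => dist_nonneg)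
      hdist.1]
    simp only [← edist_dist]
    rfl
  refine ENNReal.ofReal_le_of_le_toReal ?_
  rw [hcost]
  have : Nonempty {φ : X → ℝ // LipschitzWith 1 φ} := ⟨⟨_, LipschitzWith.const' (0 : ℝ)⟩⟩
  refine ciSup_le fun φ => ?_
  have hφm := φ.2.continuous.measurable
  have i2 : Integrable (fun q : X × X => φ.1 q.2) ρ := by
    have := hm.integrable_of_lipschitzWith φ.2
    rw [← h2] at this
    exact this.comp_measurable measurable_snd
  have i1 : Integrable (fun q : X × X => φ.1 q.1) ρ := by
    refine Integrable.mono' (i2.norm.add hdist)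
      (hφm.comp measurable_fst).aestronglyMeasurable
      (Filter.Eventually.of_forall fun q => ?_)
    have h := φ.2.dist_le_mul q.1 q.2
    rw [Real.dist_eq, NNReal.coe_one, one_mul] at h
    have h2 := abs_sub_abs_le_abs_sub (φ.1 q.1) (φ.1 q.2)
    simp only [Pi.add_apply, Real.norm_eq_abs]
    linarith
  have e1 : ∫ x, φ.1 x ∂(empirical p) = ∫ q, φ.1 q.1 ∂ρ := by
    rw [← h1, integral_map measurable_fst.aemeasurable hφm.aestronglyMeasurable]
  have e2 : ∫ x, φ.1 x ∂m = ∫ q, φ.1 q.2 ∂ρ := by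
    rw [← h2, integral_map measurable_snd.aemeasurable hφm.aestronglyMeasurable]
  rw [e1, e2, ← integral_sub i1 i2]
  refine integral_mono (i1.sub i2) hdist fun q => ?_
  have h := φ.2.dist_le_mul q.1 q.2
  rw [Real.dist_eq, NNReal.coe_one, one_mul] at h
  exact (le_abs_self _).trans h

theorem IsOptimalAllocation.isOptimalPlan (hm : HasFirstMoment m) {p : Fin N → X}
    {w : Fin N → X → ℝ} (hw : IsOptimalAllocation m p w) :
    IsOptimalPlan (empirical p) m (allocationMeasure p w m) :=
  ⟨⟨isProbabilityMeasure_allocationMeasure hw.isAllocation,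
    map_fst_allocationMeasure hw.isAllocation hw.mass,
    map_snd_allocationMeasure hw.isAllocation⟩,
    fun _ hρ' => hw.transportCost_le.trans (d1_le_transportCost hm p hρ')⟩

/-- Comparison with the plan of an optimal allocation; it makes the final estimate valid for every
optimal plan, not only the constructed one. -/
theorem IsOptimalPlan.transportCost_le (hm : HasFirstMoment m) {p : Fin N → X}
    {ρ : Measure (X × X)} (hρ : IsOptimalPlan (empirical p) m ρ) :
    transportCost ρ ≤ ENNReal.ofReal (d1 (empirical p) m) := by
  obtain ⟨w, hw⟩ := exists_isOptimalAllocation hm p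
  exact (hρ.2 _ (hw.isOptimalPlan hm).1).trans hw.transportCost_le

end Transport

end MFO

namespace MFO

/-! ### Compactness and measurability of the bridging sets -/

section Selection

open Filter Topology

variable {X Y H : Type*} [MetricSpace X] [MetricSpace Y] [NormedAddCommGroup H]
  {F : X → Set Y} {g : graph F → H} {Lg : ℝ≥0}

/-- The projection of the graph on its first component. -/
def base (F : X → Set Y) (z : graph F) : X := z.1.1

theorem continuous_base : Continuous (base F) := by unfold base; fun_prop

theorem continuous_pt (x : X) : Continuous (pt F x) := by unfold pt; fun_prop

theorem range_pt (x : X) : Set.range (pt F x) = base F ⁻¹' {x} := by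
  ext z
  constructor
  · rintro ⟨y, rfl⟩
    rfl
  · rintro rfl
    exact ⟨⟨z.1.2, z.2⟩, rfl⟩

theorem isCompact_preimage_base (hc : ∀ x, IsCompact (F x)) (x : X) :
    IsCompact (base F ⁻¹' {x}) := by
  have := isCompact_iff_compactSpace.1 (hc x)
  rw [← range_pt]
  exact isCompact_range (continuous_pt x)

/-- The graph of an upper semicontinuous compact-valued map is proper over its base. -/
theorem isProperMap_base (hF : IsData F) (hc : ∀ x, IsCompact (F x))
    (hu : UpperHemicontinuous F) : IsProperMap (base F) := by
  refine isProperMap_iff_isClosedMap_and_compact_fibers.2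
    ⟨continuous_base, fun C hC => ?_, fun x => isCompact_preimage_base hc x⟩
  have hC' : IsClosed ((↑) '' C : Set (X × Y)) := hF.closed_graph.isClosedMap_subtype_val C hC
  rw [← isOpen_compl_iff, isOpen_iff_mem_nhds]
  intro x hx
  have hsub : ({x} : Set X) ×ˢ F x ⊆ ((↑) '' C : Set (X × Y))ᶜ := by
    rintro ⟨x', y⟩ ⟨rfl, hy⟩ ⟨z, hz, hzy⟩
    exact hx ⟨z, hz, congrArg Prod.fst hzy⟩
  -- The compact fibre over `x` misses the closed set, so a tube `u ×ˢ v` around it does too; upper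
  -- semicontinuity keeps the nearby fibres inside `v`.
  obtain ⟨u, v, hu1, hv1, hxu, hFv, huv⟩ :=
    generalized_tube_lemma isCompact_singleton (hc x) hC'.isOpen_compl hsub
  have h1 : ∀ᶠ x' in 𝓝 x, F x' ⊆ v :=
    upperHemicontinuousAt_iff_forall_isOpen.1 (hu x) v hv1 hFv
  filter_upwards [h1, hu1.mem_nhds (hxu rfl)] with x' hx' hx'u
  rintro ⟨z, hz, rfl⟩
  exact huv (Set.mk_mem_prod hx'u (hx' z.2)) ⟨z, hz, rfl⟩

theorem bridgeSet_nonempty (h₂ : Assumption2 F g Lg) (p : graph F × X) :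
    (bridgeSet F g Lg p).Nonempty := by
  have h1 : g p.1 ∈ contributions F g p.1.1.1 := ⟨⟨p.1.1.2, p.1.2⟩, rfl⟩
  obtain ⟨_, ⟨y, rfl⟩, b, hb, hab⟩ := h₂.lipschitz p.1.1.1 p.2 h1
  refine ⟨pt F p.2 y, rfl, ?_⟩
  rw [norm_sub_rev, ← hab]
  simpa using hb

/-- The set of `p` at which `bridgeSet` hits a closed `C` is the image of a closed subset of `Z × Z`
under the identity times the projection to `X`. That map is proper, so the image is closed. -/
theorem measurableCompactValued_bridgeSet [MeasurableSpace X] [BorelSpace X]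
    [SecondCountableTopology X] [MeasurableSpace Y] [BorelSpace Y] [SecondCountableTopology Y]
    (hF : IsData F) (h₂ : Assumption2 F g Lg) :
    MeasurableCompactValued (bridgeSet F g Lg) where
  nonempty := bridgeSet_nonempty h₂
  isCompact p := by
    have hg := h₂.continuous
    have hcl : IsClosed {z : graph F | ‖g z - g p.1‖ ≤ Lg * dist p.1.1.1 p.2} :=
      isClosed_le (by fun_prop) continuous_const
    exact (isCompact_preimage_base h₂.compact p.2).inter_right hcl
  measurable_hit C hC := by
    have hg := h₂.continuous
    have hb := continuous_base (F := F)
    have hle : IsClosed {q : graph F × graph F |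
        ‖g q.2 - g q.1‖ ≤ Lg * dist (base F q.1) (base F q.2)} :=
      isClosed_le (by fun_prop) (by fun_prop)
    have hD := (hC.preimage (continuous_snd (X := graph F))).inter hle
    have himage := (isProperMap_id.prodMap (isProperMap_base hF h₂.compact h₂.usc)
      |>.isClosedMap _ hD : IsClosed (Prod.map (id : graph F → graph F) (base F) '' _))
    convert himage.measurableSet using 1
    ext p
    constructor
    · rintro ⟨z, ⟨hz1, hz2⟩, hzC⟩
      have hz1' : base F z = p.2 := hz1
      exact ⟨(p.1, z), ⟨hzC, by rw [Set.mem_ofPred_eq, hz1']; exact hz2⟩, Prod.ext rfl hz1⟩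
    · rintro ⟨⟨z₀, z⟩, ⟨hzC, hz⟩, rfl⟩
      exact ⟨z, ⟨rfl, hz⟩, hzC⟩

end Selection

/-! ### The bridging method -/

section Bridging

variable {X Y H : Type*} [MetricSpace X] [MeasurableSpace X] [BorelSpace X]
  [SecondCountableTopology X] [MetricSpace Y] [MeasurableSpace Y] [BorelSpace Y]
  [SecondCountableTopology Y] [NormedAddCommGroup H]
  {F : X → Set Y} {g : graph F → H} {Lg : ℝ≥0}

theorem measurable_base : Measurable (base F) := continuous_base.measurable

theorem exists_measurable_bridge (hF : IsData F) (h₂ : Assumption2 F g Lg) :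
    ∃ s : graph F × X → graph F, Measurable s ∧ ∀ p, s p ∈ bridgeSet F g Lg p :=
  (measurableCompactValued_bridgeSet hF h₂).exists_measurable_selection

theorem map_mem_admissible {ν : Measure (graph F × X)} [IsProbabilityMeasure ν]
    {s : graph F × X → graph F} (hs : Measurable s) (hsS : ∀ p, s p ∈ bridgeSet F g Lg p) :
    ν.map s ∈ admissible F (ν.map Prod.snd) := by
  refine ⟨Measure.isProbabilityMeasure_map hs.aemeasurable, ?_⟩
  change (ν.map s).map (base F) = _
  rw [Measure.map_map measurable_base hs]
  congr 1
  exact funext fun p => (hsS p).1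

theorem integrable_of_bounded (hg : Continuous g) {R : ℝ} (hR : ∀ z, ‖g z‖ ≤ R)
    (μ : Measure (graph F)) [IsFiniteMeasure μ] : Integrable g μ :=
  .of_bound hg.aestronglyMeasurable R (Filter.Eventually.of_forall hR)

variable [InnerProductSpace ℝ H]

/-- The pointwise displacement bound of the selection, integrated. Allowing any `ν` lets the same
estimate serve from `m_N` to `m` and back. -/
theorem norm_integral_map_sub_le (hg : Continuous g) {R : ℝ} (hR : ∀ z, ‖g z‖ ≤ R)
    {ν : Measure (graph F × X)} [IsProbabilityMeasure ν]
    {s : graph F × X → graph F} (hs : Measurable s) (hsS : ∀ p, s p ∈ bridgeSet F g Lg p)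
    {c : ℝ} (hc0 : 0 ≤ c) (hc : ∫⁻ p, edist (base F p.1) p.2 ∂ν ≤ ENNReal.ofReal c) :
    ‖∫ z, g z ∂(ν.map s) - ∫ z, g z ∂(ν.map Prod.fst)‖ ≤ Lg * c := by
  have hb := measurable_base (F := F)
  have hdm : Measurable fun p : graph F × X => dist (base F p.1) p.2 := by fun_prop
  have hdi : Integrable (fun p : graph F × X => dist (base F p.1) p.2) ν := by
    refine ⟨hdm.aestronglyMeasurable, ?_⟩
    rw [hasFiniteIntegral_iff_ofReal (Filter.Eventually.of_forall fun _ => dist_nonneg)]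
    simp only [← edist_dist]
    exact hc.trans_lt ENNReal.ofReal_lt_top
  have hcost : ∫ p, dist (base F p.1) p.2 ∂ν ≤ c := by
    rw [integral_eq_lintegral_of_nonneg_ae (Filter.Eventually.of_forall fun _ => dist_nonneg)
      hdi.1]
    simp only [← edist_dist]
    exact ENNReal.toReal_le_of_le_ofReal hc0 hc
  have : IsProbabilityMeasure (ν.map s) := Measure.isProbabilityMeasure_map hs.aemeasurable
  have : IsProbabilityMeasure (ν.map Prod.fst) :=
    Measure.isProbabilityMeasure_map measurable_fst.aemeasurable
  have i1 : Integrable (fun p => g (s p)) ν := (integrable_of_bounded hg hR (ν.map s)).comp_measurable hs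
  have i2 : Integrable (fun p => g p.1) ν :=
    (integrable_of_bounded hg hR (ν.map Prod.fst)).comp_measurable measurable_fst
  rw [integral_map hs.aemeasurable hg.aestronglyMeasurable,
    integral_map measurable_fst.aemeasurable hg.aestronglyMeasurable]
  calc ‖∫ p, g (s p) ∂ν - ∫ p, g p.1 ∂ν‖ = ‖∫ p, (g (s p) - g p.1) ∂ν‖ := by
        rw [← integral_sub i1 i2]
    _ ≤ ∫ p, Lg * dist (base F p.1) p.2 ∂ν :=
        norm_integral_le_of_norm_le (hdi.const_mul _) (Filter.Eventually.of_forall fun p =>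
          (hsS p).2)
    _ = Lg * ∫ p, dist (base F p.1) p.2 ∂ν := integral_const_mul _ _
    _ ≤ Lg * c := mul_le_mul_of_nonneg_left hcost Lg.coe_nonneg

variable {m : Measure X} [IsProbabilityMeasure m] {N : ℕ} [NeZero N] {x : Fin N → X}

/-- The bridging method can be carried out, measurably with respect to the profile. -/
theorem exists_measurable_isBridgingOutput {Ω : Type*} [MeasurableSpace Ω] (hF : IsData F)
    (h₂ : Assumption2 F g Lg) (hm : HasFirstMoment m) {y : Ω → (i : Fin N) → F (x i)}
    (hy : Measurable y) :
    ∃ μt : Ω → Measure (graph F), Measurable μt ∧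
      ∀ ω, IsBridgingOutput F g Lg (empirical x) m
        (empirical fun i => pt F (x i) (y ω i)) (μt ω) := by
  obtain ⟨w, hw⟩ := exists_isOptimalAllocation hm x
  obtain ⟨s, hs, hsS⟩ := exists_measurable_bridge hF h₂
  have hmap := fun ω => map_prodMap_allocationMeasure (z := fun i => pt F (x i) (y ω i)) (m := m)
    hw.isAllocation (measurable_base (F := F))
  refine ⟨fun ω => (allocationMeasure (fun i => pt F (x i) (y ω i)) w m).map s, ?_, fun ω =>
    ⟨allocationMeasure x w m, hw.isOptimalPlan hm,
      allocationMeasure (fun i => pt F (x i) (y ω i)) w m,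
      isProbabilityMeasure_allocationMeasure hw.isAllocation,
      map_fst_allocationMeasure hw.isAllocation hw.mass, hmap ω, s, hs, hsS, rfl⟩⟩
  -- The weights `w` and the selection `s` do not depend on `ω`; only the atoms do. The mass of `A`
  -- is thus a finite sum of section measures evaluated at measurable points.
  refine Measure.measurable_of_measurable_coe _ fun A hA => ?_
  have hpt : ∀ i, Measurable fun ω => pt F (x i) (y ω i) := fun i =>
    (continuous_pt (x i)).measurable.comp ((measurable_pi_apply i).comp hy)
  simp only [Measure.map_apply hs hA, allocationMeasure, Measure.finsetSum_apply]
  refine Finset.measurable_fun_sum _ fun i _ => ?_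
  simp only [Measure.dirac_prod, Measure.map_apply measurable_prodMk_left (hs hA)]
  exact (measurable_measure_prodMk_left (hs hA)).comp (hpt i)

/-- Outputs of the bridging method are admissible, and close to the input. -/
theorem IsBridgingOutput.mem_admissible_and_norm_le (hg : Continuous g) {R : ℝ}
    (hR : ∀ z, ‖g z‖ ≤ R) (hm : HasFirstMoment m) {μ₀ μ₁ : Measure (graph F)}
    (h : IsBridgingOutput F g Lg (empirical x) m μ₀ μ₁) :
    μ₁ ∈ admissible F m ∧
      ‖∫ z, g z ∂μ₁ - ∫ z, g z ∂μ₀‖ ≤ Lg * d1 (empirical x) m := by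
  obtain ⟨ρ, hρ, ν, hν, hν0, hνρ, s, hs, hsS, rfl⟩ := h
  have hb := measurable_base (F := F)
  have hpair : Measurable fun p : graph F × X => (p.1.1.1, p.2) :=
    (hb.comp measurable_fst).prodMk measurable_snd
  have hsnd : ν.map Prod.snd = m := by
    rw [← hρ.1.2.2, ← hνρ, Measure.map_map measurable_snd hpair]
    rfl
  refine ⟨hsnd ▸ map_mem_admissible hs hsS, ?_⟩
  rw [← hν0]
  refine norm_integral_map_sub_le hg hR hs hsS (d1_nonneg hm x) ?_
  refine le_trans (le_of_eq ?_) (hρ.transportCost_le hm)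
  rw [transportCost, ← hνρ, lintegral_map (by fun_prop) hpair]
  rfl

/-- Conversely, admissible measures for `m` are close to admissible measures for the empirical
distribution. -/
theorem exists_admissible_empirical_norm_le (hF : IsData F) (h₂ : Assumption2 F g Lg) {R : ℝ}
    (hR : ∀ z, ‖g z‖ ≤ R) (hm : HasFirstMoment m) (x : Fin N → X) {μ : Measure (graph F)}
    (hμ : μ ∈ admissible F m) :
    ∃ μ' ∈ admissible F (empirical x),
      ‖∫ z, g z ∂μ' - ∫ z, g z ∂μ‖ ≤ Lg * d1 (empirical x) m := by
  obtain ⟨hprob, hμm⟩ := hμ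
  obtain ⟨w, hw⟩ := exists_isOptimalAllocation hm x
  obtain ⟨s, hs, hsS⟩ := exists_measurable_bridge hF h₂
  have hb := measurable_base (F := F)
  have hμm' : μ.map (base F) = m := hμm
  -- Weights pulled back to `Z`: they couple `μ` directly with the empirical distribution, with the
  -- cost of the original allocation.
  let w' : Fin N → graph F → ℝ := fun i z => w i (base F z)
  have hw' : IsAllocation w' :=
    ⟨fun i => (hw.isAllocation.measurable i).comp hb, fun i z => hw.isAllocation.nonneg i _,
      fun z => hw.isAllocation.sum_eq_one _⟩
  have hmass : ∀ i, ∫ z, w' i z ∂μ = (N : ℝ)⁻¹ := fun i => by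
    rw [← hw.mass i, ← hμm', integral_map hb.aemeasurable
      (hw.isAllocation.measurable i).aestronglyMeasurable]
  have := isProbabilityMeasure_allocationMeasure (z := x) (m := μ) hw'
  set ν : Measure (graph F × X) := (allocationMeasure x w' μ).map Prod.swap with hν
  have : IsProbabilityMeasure ν := Measure.isProbabilityMeasure_map measurable_swap.aemeasurable
  have hfst : ν.map Prod.fst = μ := by
    rw [hν, Measure.map_map measurable_fst measurable_swap]
    exact map_snd_allocationMeasure hw'
  have hsnd : ν.map Prod.snd = empirical x := by
    rw [hν, Measure.map_map measurable_snd measurable_swap]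
    exact map_fst_allocationMeasure hw' hmass
  refine ⟨ν.map s, hsnd ▸ map_mem_admissible hs hsS, ?_⟩
  rw [← hfst]
  refine norm_integral_map_sub_le h₂.continuous hR hs hsS (d1_nonneg hm x) ?_
  refine le_trans (le_of_eq ?_) hw.cost_le
  rw [hν, lintegral_map (by fun_prop) measurable_swap,
    lintegral_allocationMeasure hw' (by fun_prop)]
  refine Finset.sum_congr rfl fun i _ => ?_
  have hwm := hw.isAllocation.measurable i
  rw [← hμm', lintegral_map (by fun_prop) hb]
  exact lintegral_congr fun z => by simp [w', edist_comm]

end Bridging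

end MFO

/-! ### Bernoulli variables -/

section Bernoulli

variable {Ω : Type*}

/-- The indicator of a random Boolean. -/
def boolIndicator (B : Ω → Bool) (ω : Ω) : ℝ := if B ω then 1 else 0

theorem measurable_boolIndicator {m' : MeasurableSpace Ω} {B : Ω → Bool} (hB : Measurable[m'] B) :
    Measurable[m'] (boolIndicator B) :=
  (measurable_of_countable fun b : Bool => if b then (1 : ℝ) else 0).comp hB

theorem norm_boolIndicator_le (B : Ω → Bool) (ω : Ω) : ‖boolIndicator B ω‖ ≤ 1 := by
  unfold boolIndicator
  split_ifs <;> simp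

variable {mΩ : MeasurableSpace Ω} {Pr : Measure Ω}

theorem integral_boolIndicator {B : Ω → Bool} (hB : Measurable B) {p : unitInterval}
    (hlaw : Pr.map B = bernoulliMeasure true false p) :
    ∫ ω, boolIndicator B ω ∂Pr = p := by
  have h : ∫ ω, boolIndicator B ω ∂Pr = ∫ b, (if b then (1 : ℝ) else 0) ∂(Pr.map B) := by
    rw [integral_map hB.aemeasurable (measurable_of_countable _).aestronglyMeasurable]
    rfl
  rw [h, hlaw, integral_bernoulliMeasure]
  simp

theorem integral_boolIndicator_mul [IsProbabilityMeasure Pr] {B : Ω → Bool} (hB : Measurable B) {p : unitInterval}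
    (hlaw : Pr.map B = bernoulliMeasure true false p) {m' : MeasurableSpace Ω} (hm' : m' ≤ mΩ)
    (hind : Indep (MeasurableSpace.comap B inferInstance) m' Pr) {Z : Ω → ℝ}
    (hZ : Measurable[m'] Z) :
    ∫ ω, boolIndicator B ω * Z ω ∂Pr = p * ∫ ω, Z ω ∂Pr := by
  have hindep : IndepFun (boolIndicator B) Z Pr := by
    rw [IndepFun_iff_Indep]
    refine indep_of_indep_of_le_left (indep_of_indep_of_le_right hind hZ.comap_le) ?_
    exact (measurable_boolIndicator (comap_measurable B)).comap_le
  have hB' : Measurable[mΩ] (boolIndicator B) := measurable_boolIndicator hB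
  have hZ' : Measurable[mΩ] Z := hZ.mono hm' le_rfl
  rw [hindep.integral_fun_mul_eq_mul_integral
    hB'.aestronglyMeasurable
    hZ'.aestronglyMeasurable, integral_boolIndicator hB hlaw]

end Bernoulli

/-! ### Solution of the Frank–Wolfe recursion -/

section Recursion

/-- The rate obtained from the Frank–Wolfe recursion. -/
theorem le_div_of_frankWolfe_recursion {e : ℕ → ℝ} {c : ℝ} (hc : 0 ≤ c) {N K : ℕ} (hN : 0 < N)
    (hK : 1 ≤ K) (hKN : K ≤ 2 * N)
    (h : ∀ k < K, e (k + 1) ≤ (1 - 2 / ((k : ℝ) + 2)) * e k +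
      c / 2 * ((2 / ((k : ℝ) + 2)) ^ 2 + 2 / ((k : ℝ) + 2) * (1 - 2 / ((k : ℝ) + 2)) / N)) :
    e K ≤ 4 * c / K := by
  have hN' : (0 : ℝ) < N := Nat.cast_pos.2 hN
  -- Multiplying the recursion by `(k + 1) * (k + 2)` makes the left side telescope, with increments
  -- at most `c * (2 + k / N)`. No bound on `e 0` is needed, because its weight vanishes.
  have key : ∀ k ≤ K, (k : ℝ) * (k + 1) * e k ≤ c * (2 * k + k * (k - 1) / (2 * N)) := by
    intro k
    induction k with
    | zero => simp
    | succ k ih =>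
      intro hk
      have h1 := ih (by omega)
      have h2 := h k (by omega)
      have hk0 : (0 : ℝ) ≤ k := Nat.cast_nonneg k
      have hpos : (0 : ℝ) < (k + 1) * (k + 2) := by positivity
      have h3 := mul_le_mul_of_nonneg_left h2 hpos.le
      have h4 : ((k : ℝ) + 1) * (k + 2) * ((1 - 2 / ((k : ℝ) + 2)) * e k +
          c / 2 * ((2 / ((k : ℝ) + 2)) ^ 2 + 2 / ((k : ℝ) + 2) * (1 - 2 / ((k : ℝ) + 2)) / N)) =
          k * (k + 1) * e k + (k + 1) / (k + 2) * (c * (2 + k / N)) := by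
        field_simp
        ring
      have h5 : ((k : ℝ) + 1) / (k + 2) * (c * (2 + k / N)) ≤ 1 * (c * (2 + k / N)) := by
        refine mul_le_mul_of_nonneg_right ?_ (by positivity)
        rw [div_le_one (by positivity)]
        linarith
      have h6 : c * (2 * k + k * (k - 1) / (2 * N)) + 1 * (c * (2 + k / N)) =
          c * (2 * (k + 1 : ℝ) + (k + 1) * ((k + 1) - 1) / (2 * N)) := by
        field_simp
        ring
      push_cast
      have h7 : ((k : ℝ) + 1) * (k + 1 + 1) * e (k + 1) = (k + 1) * (k + 2) * e (k + 1) := by ring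
      rw [h7]
      linarith
  have h1 := key K le_rfl
  have hK' : (1 : ℝ) ≤ K := by exact_mod_cast hK
  have hKN' : (K : ℝ) ≤ 2 * N := by exact_mod_cast hKN
  have h2 : (K : ℝ) * (K - 1) / (2 * N) ≤ K := by
    rw [div_le_iff₀ (by positivity)]
    nlinarith
  rw [le_div_iff₀ (by positivity)]
  -- Since `K ≤ 2 * N`, the bound `key` yields `(K + 1) * e K ≤ 3 * c`, which is stronger than the
  -- claim.
  by_contra! hcon
  have h3 : c * (2 * K + K * (K - 1) / (2 * N)) ≤ c * (3 * K) :=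
    mul_le_mul_of_nonneg_left (by linarith) hc
  have h4 : (K + 1 : ℝ) * (4 * c) ≤ (K + 1) * (e K * K) :=
    mul_le_mul_of_nonneg_left hcon.le (by positivity)
  have h5 : (K : ℝ) * (K + 1) * e K = (K + 1) * (e K * K) := by ring
  have h6 : (0 : ℝ) ≤ c * K := by positivity
  have h7 : c = 0 := by nlinarith
  rw [h7] at hcon h1
  nlinarith

end Recursion

/-! ### The stochastic Frank–Wolfe algorithm -/

namespace MFO

section Bounds

variable {H : Type*} [NormedAddCommGroup H] [InnerProductSpace ℝ H] [CompleteSpace H]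
  {f : H → ℝ} {L : ℝ≥0}

theorem norm_gradient_le (hL : LipschitzWith L (gradient f)) {R : ℝ} {b : H} (hb : ‖b‖ ≤ R) :
    ‖gradient f b‖ ≤ ‖gradient f 0‖ + L * R := by
  have h1 := hL.norm_sub_le b 0
  rw [sub_zero] at h1
  have h2 := norm_le_norm_add_norm_sub (gradient f 0) (gradient f b)
  rw [norm_sub_rev] at h2
  have h3 := mul_le_mul_of_nonneg_left hb L.coe_nonneg
  linarith

/-- The tangent at `0` bounds `f` from below and the descent inequality at `0` from above. Used for
the integrability of random costs. -/
theorem exists_abs_le_of_norm_le (hc : ConvexOn ℝ Set.univ f) (hf : Differentiable ℝ f)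
    (hL : LipschitzWith L (gradient f)) (R : ℝ) : ∃ A, ∀ b, ‖b‖ ≤ R → ‖f b‖ ≤ A := by
  refine ⟨|f 0| + ‖gradient f 0‖ * R + L / 2 * R ^ 2, fun b hb => ?_⟩
  have h1 := hL.le_add_inner_gradient_add hf 0 b
  have h2 := hc.add_inner_gradient_le hf b 0
  rw [zero_add] at h1
  rw [sub_zero] at h2
  have h3 := abs_le.1 ((abs_real_inner_le_norm (gradient f 0) b).trans
    (mul_le_mul_of_nonneg_left hb (norm_nonneg _)))
  have h4 : (L : ℝ) / 2 * ‖b‖ ^ 2 ≤ L / 2 * R ^ 2 :=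
    mul_le_mul_of_nonneg_left (pow_le_pow_left₀ (norm_nonneg _) hb 2) (by positivity)
  have h5 : (0 : ℝ) ≤ L / 2 * R ^ 2 := by positivity
  have h6 := le_abs_self (f 0)
  have h7 := neg_abs_le (f 0)
  rw [Real.norm_eq_abs, abs_le]
  constructor <;> linarith [h3.1, h3.2]

end Bounds

section Profile

variable {X Y H : Type*} [NormedAddCommGroup H]
  {F : X → Set Y} {g : graph F → H} {N : ℕ} {x : Fin N → X}

/-- The change of the contribution of the `i`-th agent if it switches to its best response. -/
def jump (g : graph F → H) (x : Fin N → X) (q : ((i : Fin N) → F (x i)) × ((i : Fin N) → F (x i)))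
    (i : Fin N) : H :=
  g (pt F (x i) (q.2 i)) - g (pt F (x i) (q.1 i))

theorem bddAbove_constD {R : ℝ} (hR : ∀ z, ‖g z‖ ≤ R) :
    BddAbove (Set.range fun p : graph F × graph F => ‖g p.1 - g p.2‖ ^ 2) := by
  refine ⟨(R + R) ^ 2, Set.forall_mem_range.2 fun p => ?_⟩
  exact pow_le_pow_left₀ (norm_nonneg _)
    ((norm_sub_le _ _).trans (add_le_add (hR _) (hR _))) 2

theorem norm_jump_sq_le {R : ℝ} (hR : ∀ z, ‖g z‖ ≤ R)
    (q : ((i : Fin N) → F (x i)) × ((i : Fin N) → F (x i))) (i : Fin N) :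
    ‖jump g x q i‖ ^ 2 ≤ constD F g :=
  le_ciSup (bddAbove_constD hR) (pt F (x i) (q.2 i), pt F (x i) (q.1 i))

theorem constD_nonneg : 0 ≤ constD F g := Real.iSup_nonneg fun _ => sq_nonneg _

theorem continuous_contribution [TopologicalSpace X] [TopologicalSpace Y] (hg : Continuous g)
    (i : Fin N) :
    Continuous fun y : (i : Fin N) → F (x i) => g (pt F (x i) (y i)) := by
  unfold pt
  fun_prop

theorem continuous_jump [TopologicalSpace X] [TopologicalSpace Y] (hg : Continuous g)
    (i : Fin N) :
    Continuous fun q => jump g x q i :=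
  ((continuous_contribution hg i).comp continuous_snd).sub
    ((continuous_contribution hg i).comp continuous_fst)

variable [InnerProductSpace ℝ H]

theorem aggregate_candidate (y ybar : (i : Fin N) → F (x i)) (B : Fin N → Bool) :
    aggregate F g x (candidate F x y ybar B) = aggregate F g x y +
      (N : ℝ)⁻¹ • ∑ i, (if B i then (1 : ℝ) else 0) • jump g x (y, ybar) i := by
  rw [aggregate, aggregate, ← smul_add, ← Finset.sum_add_distrib]
  congr 1
  refine Finset.sum_congr rfl fun i _ => ?_
  by_cases h : B i <;> simp [candidate, jump, h]

theorem norm_aggregate_le [NeZero N] {R : ℝ} (hR : ∀ z, ‖g z‖ ≤ R) (y : (i : Fin N) → F (x i)) :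
    ‖aggregate F g x y‖ ≤ R := by
  have hN : (0 : ℝ) < N := Nat.cast_pos.2 (NeZero.pos N)
  rw [aggregate, norm_smul, Real.norm_of_nonneg (by positivity), inv_mul_le_iff₀ hN]
  refine (norm_sum_le _ _).trans ((Finset.sum_le_sum fun i _ => hR _).trans ?_)
  simp

theorem norm_smul_sum_smul_sq (ξ : Fin N → ℝ) (v : Fin N → H) :
    ‖(N : ℝ)⁻¹ • ∑ i, ξ i • v i‖ ^ 2 =
      ((N : ℝ)⁻¹) ^ 2 * ∑ i, ∑ l, ξ i * ξ l * inner ℝ (v i) (v l) := by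
  rw [norm_smul, mul_pow, Real.norm_eq_abs, sq_abs, ← real_inner_self_eq_norm_sq, sum_inner]
  congr 1
  refine Finset.sum_congr rfl fun i _ => ?_
  rw [inner_sum]
  refine Finset.sum_congr rfl fun l _ => ?_
  rw [real_inner_smul_left, real_inner_smul_right, mul_assoc]

theorem abs_inner_jump_le {R : ℝ} (hR : ∀ z, ‖g z‖ ≤ R)
    (q : ((i : Fin N) → F (x i)) × ((i : Fin N) → F (x i))) (i l : Fin N) :
    |inner ℝ (jump g x q i) (jump g x q l)| ≤ constD F g := by
  have h1 := abs_real_inner_le_norm (jump g x q i) (jump g x q l)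
  have h2 := norm_jump_sq_le hR q i
  have h3 := norm_jump_sq_le hR q l
  nlinarith [sq_nonneg (‖jump g x q i‖ - ‖jump g x q l‖)]

theorem continuous_aggregate [TopologicalSpace X] [TopologicalSpace Y] (hg : Continuous g) :
    Continuous (aggregate F g x) :=
  (continuous_finsetSum _ fun i _ => continuous_contribution hg i).const_smul _

end Profile

/-! ### The Frank–Wolfe gap -/

section Gap

variable {X Y H : Type*} [MetricSpace X] [MeasurableSpace X] [BorelSpace X]
  [SecondCountableTopology X] [MetricSpace Y] [MeasurableSpace Y] [BorelSpace Y]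
  [SecondCountableTopology Y] [NormedAddCommGroup H] [InnerProductSpace ℝ H] [CompleteSpace H]
  {F : X → Set Y} {g : graph F → H} {f : H → ℝ} {N : ℕ} [NeZero N] {x : Fin N → X}

/-- Best responses minimize the linearized cost among the admissible measures. -/
theorem sum_inner_le_inner_integral (hg : Continuous g) {R : ℝ} (hR : ∀ z, ‖g z‖ ≤ R) {lam : H}
    (hne : ∀ x, (BR F g lam x).Nonempty) {ybar : (i : Fin N) → F (x i)}
    (hybar : ∀ i, ybar i ∈ BR F g lam (x i)) {μ : Measure (graph F)}
    (hμ : μ ∈ admissible F (empirical x)) :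
    inner ℝ lam (aggregate F g x ybar) ≤ inner ℝ lam (∫ z, g z ∂μ) := by
  classical
  obtain ⟨hprob, hmarg⟩ := hμ
  have hmarg' : μ.map (base F) = empirical x := hmarg
  choose yhat hyhat using hne
  let V : X → ℝ := fun a => gLin F g lam (pt F a (yhat a))
  -- The value function `V` of the linearized problem comes with no measurability. Cut off outside
  -- the finitely many `x i`, which carry the marginal of `μ`, it becomes measurable.
  let v : X → ℝ := (Set.range x).indicator V
  have hfin := Set.finite_range x
  have hv : Measurable v := by
    refine (measurable_const (a := (0 : ℝ))).measurable_of_countable_ne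
      (hfin.countable.mono fun a ha => ?_)
    by_contra hcon
    exact ha (Set.indicator_of_notMem hcon V).symm
  have hvx : ∀ i, v (x i) = V (x i) := fun i => Set.indicator_of_mem (Set.mem_range_self i) V
  have hae : ∀ᵐ z ∂μ, base F z ∈ Set.range x := by
    have h1 : ∀ᵐ a ∂(μ.map (base F)), a ∈ Set.range x := by
      rw [hmarg', ae_iff]
      change empirical x (Set.range x)ᶜ = 0
      rw [← lintegral_indicator_one hfin.measurableSet.compl,
        lintegral_empirical x (measurable_one.indicator hfin.measurableSet.compl)]
      simp
    exact ae_of_ae_map measurable_base.aemeasurable h1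
  have hgint := integrable_of_bounded hg hR μ
  have hvint : Integrable (fun z => v (base F z)) μ := by
    obtain ⟨A, hA⟩ : ∃ A, ∀ a, ‖v a‖ ≤ A := by
      refine ⟨‖lam‖ * R, fun a => ?_⟩
      refine (norm_indicator_le_norm_self V a).trans ?_
      exact (norm_inner_le_norm _ _).trans (mul_le_mul_of_nonneg_left (hR _) (norm_nonneg _))
    exact .of_bound (hv.comp measurable_base).aestronglyMeasurable A
      (Filter.Eventually.of_forall fun z => hA _)
  rw [← integral_inner hgint]
  calc inner ℝ lam (aggregate F g x ybar)
      = (N : ℝ)⁻¹ * ∑ i, gLin F g lam (pt F (x i) (ybar i)) := by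
        rw [aggregate, real_inner_smul_right, inner_sum]; rfl
    _ ≤ (N : ℝ)⁻¹ * ∑ i, v (x i) := by
        refine mul_le_mul_of_nonneg_left (Finset.sum_le_sum fun i _ => ?_) (by positivity)
        rw [hvx]
        exact hybar i _
    _ = ∫ a, v a ∂(empirical x) := by
        rw [integral_empirical x hv.stronglyMeasurable, smul_eq_mul]
    _ = ∫ z, v (base F z) ∂μ := by
        rw [← hmarg', integral_map measurable_base.aemeasurable hv.aestronglyMeasurable]
    _ ≤ ∫ z, inner ℝ lam (g z) ∂μ := by
        refine integral_mono_ae hvint (hgint.const_inner lam) ?_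
        filter_upwards [hae] with z hz
        have h1 : v (base F z) = V (base F z) := Set.indicator_of_mem hz V
        rw [h1]
        exact hyhat (base F z) ⟨z.1.2, z.2⟩

/-- Best responses decrease the linearized cost at least as much as moving to `μ`, and by convexity
the linearization at the current aggregate lies below `f`. -/
theorem inner_gradient_jump_le {L : ℝ≥0} (h₁ : Assumption1 F g f L) (hg : Continuous g)
    {y ybar : (i : Fin N) → F (x i)}
    (hybar : ∀ i, ybar i ∈ BR F g (gradient f (aggregate F g x y)) (x i)) {μ : Measure (graph F)}
    (hμ : μ ∈ admissible F (empirical x)) :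
    inner ℝ (gradient f (aggregate F g x y)) ((N : ℝ)⁻¹ • ∑ i, jump g x (y, ybar) i) ≤
      f (∫ z, g z ∂μ) - f (aggregate F g x y) := by
  obtain ⟨R, hR⟩ := h₁.bounded
  have h1 := sum_inner_le_inner_integral hg hR (h₁.br_nonempty _ ⟨_, rfl⟩) hybar hμ
  have h2 := h₁.convex.add_inner_gradient_le h₁.differentiable (∫ z, g z ∂μ) (aggregate F g x y)
  have h3 : (N : ℝ)⁻¹ • ∑ i, jump g x (y, ybar) i =
      aggregate F g x ybar - aggregate F g x y := by
    simp only [jump, Finset.sum_sub_distrib, smul_sub]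
    rfl
  rw [h3, inner_sub_right]
  rw [inner_sub_right] at h2
  linarith

end Gap

end MFO

namespace MFO

/-! ### Expected decrease along a run of the algorithm -/

section Run

variable {X Y H Ω : Type*} [MeasurableSpace Y] [NormedAddCommGroup H] [InnerProductSpace ℝ H]
  [CompleteSpace H] {F : X → Set Y} {g : graph F → H} {f : H → ℝ} {L : ℝ≥0} {N : ℕ}
  {x : Fin N → X} {K : ℕ} {n : ℕ → ℕ} {mΩ : MeasurableSpace Ω} {Pr : Measure Ω}
  {y ybar : ℕ → Ω → (i : Fin N) → F (x i)} {P : (k : ℕ) → Fin (n k) → Fin N → Ω → Bool}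

namespace IsSFWRun

theorem past_le (hrun : IsSFWRun F g f x K n Pr y ybar P) {k : ℕ} (hk : k < K) (j : Fin (n k))
    (i : Fin N) : past F x n y ybar P k j i ≤ mΩ := by
  refine sup_le (sup_le ?_ ?_) ?_
  · exact iSup₂_le fun l hl => (hrun.measurable_y l (hl.trans hk.le)).comap_le
  · exact iSup₂_le fun l hl => (hrun.measurable_ybar l (hl.trans_lt hk)).comap_le
  · refine iSup_le fun l => iSup_le fun j' => iSup₂_le fun i' h => ?_
    have hl : l < K := by rcases h with h | h <;> omega
    exact (hrun.measurable_P l hl j' i').comap_le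

theorem measurable_past_profile (k : ℕ) (j : Fin (n k)) (i : Fin N) :
    Measurable[past F x n y ybar P k j i] fun ω => (y k ω, ybar k ω) := by
  have h1 : Measurable[past F x n y ybar P k j i] (y k) := by
    rw [measurable_iff_comap_le]
    exact le_sup_of_le_left (le_sup_of_le_left
      (le_iSup₂_of_le (f := fun l (_ : l ≤ k) => MeasurableSpace.comap (y l) inferInstance)
        k le_rfl le_rfl))
  have h2 : Measurable[past F x n y ybar P k j i] (ybar k) := by
    rw [measurable_iff_comap_le]
    exact le_sup_of_le_left (le_sup_of_le_right
      (le_iSup₂_of_le (f := fun l (_ : l ≤ k) => MeasurableSpace.comap (ybar l) inferInstance)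
        k le_rfl le_rfl))
  exact h1.prodMk h2

theorem measurable_past_bernoulli (k : ℕ) (j : Fin (n k)) {i l : Fin N} (hil : i < l) :
    Measurable[past F x n y ybar P k j l] (P k j i) := by
  rw [measurable_iff_comap_le]
  refine le_sup_of_le_right ?_
  refine le_iSup_of_le k (le_iSup_of_le j (le_iSup_of_le i ?_))
  exact le_iSup_of_le (Or.inr ⟨rfl, Or.inr ⟨rfl, hil⟩⟩) le_rfl

theorem integrable_bernoulli_mul (hrun : IsSFWRun F g f x K n Pr y ybar P) {k : ℕ} (hk : k < K)
    (j : Fin (n k)) (i : Fin N) {Z : Ω → ℝ} (hZ : Integrable Z Pr) :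
    Integrable (fun ω => boolIndicator (P k j i) ω * Z ω) Pr :=
  hZ.bdd_mul (measurable_boolIndicator (hrun.measurable_P k hk j i)).aestronglyMeasurable
    (Filter.Eventually.of_forall fun ω => norm_boolIndicator_le _ ω)

variable [MetricSpace Y] [BorelSpace Y] [SecondCountableTopology Y] [IsProbabilityMeasure Pr]

theorem integral_bernoulli_mul (hrun : IsSFWRun F g f x K n Pr y ybar P) {k : ℕ} (hk : k < K)
    (j : Fin (n k)) (i : Fin N)
    {ζ : ((i : Fin N) → F (x i)) × ((i : Fin N) → F (x i)) → ℝ} (hζ : Continuous ζ) :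
    ∫ ω, boolIndicator (P k j i) ω * ζ (y k ω, ybar k ω) ∂Pr =
      stepSize k * ∫ ω, ζ (y k ω, ybar k ω) ∂Pr :=
  integral_boolIndicator_mul (hrun.measurable_P k hk j i) (hrun.law_P k hk j i)
    (hrun.past_le hk j i) (hrun.indep_P k hk j i)
    (hζ.measurable.comp (measurable_past_profile k j i))

/-- The draw of agent `i < l` belongs to the past of the draw of agent `l`, so the two are factored
out one after the other, the later one first. -/
theorem integral_bernoulli_mul_mul_of_lt (hrun : IsSFWRun F g f x K n Pr y ybar P) {k : ℕ}
    (hk : k < K) (j : Fin (n k)) {i l : Fin N} (hil : i < l)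
    {ζ : ((i : Fin N) → F (x i)) × ((i : Fin N) → F (x i)) → ℝ} (hζ : Continuous ζ) :
    ∫ ω, boolIndicator (P k j l) ω * (boolIndicator (P k j i) ω * ζ (y k ω, ybar k ω)) ∂Pr =
      (stepSize k : ℝ) ^ 2 * ∫ ω, ζ (y k ω, ybar k ω) ∂Pr := by
  have hmeas : Measurable[past F x n y ybar P k j l]
      fun ω => boolIndicator (P k j i) ω * ζ (y k ω, ybar k ω) :=
    (measurable_boolIndicator (measurable_past_bernoulli k j hil)).mul
      (hζ.measurable.comp (measurable_past_profile k j l))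
  rw [integral_boolIndicator_mul (hrun.measurable_P k hk j l) (hrun.law_P k hk j l)
    (hrun.past_le hk j l) (hrun.indep_P k hk j l) hmeas, hrun.integral_bernoulli_mul hk j i hζ]
  ring

theorem integral_bernoulli_mul_mul (hrun : IsSFWRun F g f x K n Pr y ybar P) {k : ℕ}
    (hk : k < K) (j : Fin (n k)) (i l : Fin N)
    {ζ : ((i : Fin N) → F (x i)) × ((i : Fin N) → F (x i)) → ℝ} (hζ : Continuous ζ) :
    ∫ ω, boolIndicator (P k j i) ω * boolIndicator (P k j l) ω * ζ (y k ω, ybar k ω) ∂Pr =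
      ((stepSize k : ℝ) ^ 2 + if i = l then (stepSize k : ℝ) - (stepSize k : ℝ) ^ 2 else 0) *
        ∫ ω, ζ (y k ω, ybar k ω) ∂Pr := by
  rcases lt_trichotomy i l with h | rfl | h
  · rw [if_neg h.ne, add_zero, ← hrun.integral_bernoulli_mul_mul_of_lt hk j h hζ]
    exact integral_congr_ae (Filter.Eventually.of_forall fun ω => by ring)
  · rw [if_pos rfl, add_sub_cancel, ← hrun.integral_bernoulli_mul hk j i hζ]
    refine integral_congr_ae (Filter.Eventually.of_forall fun ω => ?_)
    simp only [boolIndicator]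
    split_ifs <;> ring
  · rw [if_neg h.ne', add_zero, ← hrun.integral_bernoulli_mul_mul_of_lt hk j h hζ]
    exact integral_congr_ae (Filter.Eventually.of_forall fun ω => by ring)

theorem integrable_comp_profile (hrun : IsSFWRun F g f x K n Pr y ybar P) {k : ℕ} (hk : k < K)
    {ζ : ((i : Fin N) → F (x i)) × ((i : Fin N) → F (x i)) → ℝ} (hζ : Continuous ζ) {A : ℝ}
    (hA : ∀ q, ‖ζ q‖ ≤ A) : Integrable (fun ω => ζ (y k ω, ybar k ω)) Pr :=
  .of_bound (hζ.measurable.comp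
    ((hrun.measurable_y k hk.le).prodMk (hrun.measurable_ybar k hk))).aestronglyMeasurable A
    (Filter.Eventually.of_forall fun _ => hA _)

variable [MetricSpace X] [NeZero N]

theorem integrable_cost (h₁ : Assumption1 F g f L) (hg : Continuous g)
    (hrun : IsSFWRun F g f x K n Pr y ybar P) {k : ℕ} (hk : k ≤ K) :
    Integrable (fun ω => f (aggregate F g x (y k ω))) Pr := by
  obtain ⟨R, hR⟩ := h₁.bounded
  obtain ⟨A, hA⟩ := exists_abs_le_of_norm_le h₁.convex h₁.differentiable h₁.lipschitz_gradient R
  exact .of_bound ((h₁.differentiable.continuous.comp (continuous_aggregate hg)).measurable.comp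
    (hrun.measurable_y k hk)).aestronglyMeasurable A
    (Filter.Eventually.of_forall fun ω => hA _ (norm_aggregate_le hR _))

/-- The expected decrease of the cost at one iteration. -/
theorem integral_cost_succ_le (h₁ : Assumption1 F g f L) (hg : Continuous g)
    (hrun : IsSFWRun F g f x K n Pr y ybar P) {k : ℕ} (hk : k < K) :
    ∫ ω, f (aggregate F g x (y (k + 1) ω)) ∂Pr ≤ ∫ ω, f (aggregate F g x (y k ω)) ∂Pr +
      stepSize k * ∫ ω, inner ℝ (gradient f (aggregate F g x (y k ω)))
        ((N : ℝ)⁻¹ • ∑ i, jump g x (y k ω, ybar k ω) i) ∂Pr +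
      L * constD F g / 2 * ((stepSize k : ℝ) ^ 2 + stepSize k * (1 - stepSize k) / N) := by
  obtain ⟨R, hR⟩ := h₁.bounded
  have hN : (0 : ℝ) < N := Nat.cast_pos.2 (NeZero.pos N)
  -- One simulation suffices: the next iterate costs no more than any candidate.
  let j : Fin (n k) := ⟨0, hrun.pos_n k hk⟩
  set p : ℝ := ((stepSize k : unitInterval) : ℝ)
  have hp0 : 0 ≤ p := (stepSize k).2.1
  have hp1 : p ≤ 1 := (stepSize k).2.2
  set D := constD F g
  have hD0 : 0 ≤ D := constD_nonneg
  -- The functions `ζ i` and `η i l` are the coefficients of the linear and quadratic terms of the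
  -- descent inequality in the draws `ξ i`. They depend only on the current profile and best
  -- responses, hence on the past.
  let ζ : Fin N → ((i : Fin N) → F (x i)) × ((i : Fin N) → F (x i)) → ℝ := fun i q =>
    (N : ℝ)⁻¹ * inner ℝ (gradient f (aggregate F g x q.1)) (jump g x q i)
  let η : Fin N → Fin N → ((i : Fin N) → F (x i)) × ((i : Fin N) → F (x i)) → ℝ := fun i l q =>
    ((N : ℝ)⁻¹) ^ 2 * inner ℝ (jump g x q i) (jump g x q l)
  have hgrad : Continuous fun q : ((i : Fin N) → F (x i)) × ((i : Fin N) → F (x i)) =>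
      gradient f (aggregate F g x q.1) :=
    h₁.lipschitz_gradient.continuous.comp ((continuous_aggregate hg).comp continuous_fst)
  have hζ : ∀ i, Continuous (ζ i) := fun i =>
    continuous_const.mul (hgrad.inner (continuous_jump hg i))
  have hη : ∀ i l, Continuous (η i l) := fun i l =>
    continuous_const.mul ((continuous_jump hg i).inner (continuous_jump hg l))
  have hζi : ∀ i, Integrable (fun ω => ζ i (y k ω, ybar k ω)) Pr := fun i => by
    refine hrun.integrable_comp_profile hk (hζ i)
      (A := (N : ℝ)⁻¹ * ((‖gradient f 0‖ + L * R) * (R + R))) fun q => ?_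
    rw [norm_mul, Real.norm_of_nonneg (by positivity : (0 : ℝ) ≤ (N : ℝ)⁻¹)]
    refine mul_le_mul_of_nonneg_left ?_ (by positivity)
    have h2 := norm_gradient_le (f := f) h₁.lipschitz_gradient (norm_aggregate_le hR q.1)
    exact (norm_inner_le_norm _ _).trans (mul_le_mul h2
      ((norm_sub_le _ _).trans (add_le_add (hR _) (hR _))) (norm_nonneg _)
      ((norm_nonneg _).trans h2))
  have hηb : ∀ i l q, |η i l q| ≤ ((N : ℝ)⁻¹) ^ 2 * D := fun i l q => by
    rw [abs_mul, abs_of_nonneg (by positivity : (0 : ℝ) ≤ ((N : ℝ)⁻¹) ^ 2)]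
    exact mul_le_mul_of_nonneg_left (abs_inner_jump_le hR q i l) (by positivity)
  have hηi : ∀ i l, Integrable (fun ω => η i l (y k ω, ybar k ω)) Pr := fun i l =>
    hrun.integrable_comp_profile hk (hη i l) (hηb i l)
  have hηint : ∀ i l, ∫ ω, η i l (y k ω, ybar k ω) ∂Pr ≤ ((N : ℝ)⁻¹) ^ 2 * D := fun i l => by
    refine (integral_mono (hηi i l) (integrable_const _) fun ω =>
      (le_abs_self _).trans (hηb i l _)).trans ?_
    simp
  set ξ : Fin N → Ω → ℝ := fun i => boolIndicator (P k j i)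
  have hξζ : ∀ i, Integrable (fun ω => ξ i ω * ζ i (y k ω, ybar k ω)) Pr := fun i =>
    hrun.integrable_bernoulli_mul hk j i (hζi i)
  have hξη : ∀ i l, Integrable (fun ω => ξ i ω * ξ l ω * η i l (y k ω, ybar k ω)) Pr :=
    fun i l => by
      simp only [mul_assoc]
      exact hrun.integrable_bernoulli_mul hk j i (hrun.integrable_bernoulli_mul hk j l (hηi i l))
  have hcost := integrable_cost h₁ hg hrun hk.le
  have hS1 : Integrable (fun ω => ∑ i, ξ i ω * ζ i (y k ω, ybar k ω)) Pr :=
    integrable_finsetSum _ fun i _ => hξζ i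
  have hS2 : Integrable (fun ω => ∑ i, ∑ l, ξ i ω * ξ l ω * η i l (y k ω, ybar k ω)) Pr :=
    integrable_finsetSum _ fun i _ => integrable_finsetSum _ fun l _ => hξη i l
  have hpoint : ∀ ω, f (aggregate F g x (y (k + 1) ω)) ≤ f (aggregate F g x (y k ω)) +
      ∑ i, ξ i ω * ζ i (y k ω, ybar k ω) +
      L / 2 * ∑ i, ∑ l, ξ i ω * ξ l ω * η i l (y k ω, ybar k ω) := by
    intro ω
    refine (hrun.update_min k hk ω j).trans ?_
    rw [aggregate_candidate]
    refine (h₁.lipschitz_gradient.le_add_inner_gradient_add h₁.differentiable _ _).trans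
      (le_of_eq ?_)
    have hlin : inner ℝ (gradient f (aggregate F g x (y k ω))) ((N : ℝ)⁻¹ • ∑ i,
        (if P k j i ω then (1 : ℝ) else 0) • jump g x (y k ω, ybar k ω) i) =
        ∑ i, ξ i ω * ζ i (y k ω, ybar k ω) := by
      rw [real_inner_smul_right, inner_sum, Finset.mul_sum]
      refine Finset.sum_congr rfl fun i _ => ?_
      rw [real_inner_smul_right]
      exact mul_left_comm _ _ _
    have hquad : ‖(N : ℝ)⁻¹ • ∑ i,
        (if P k j i ω then (1 : ℝ) else 0) • jump g x (y k ω, ybar k ω) i‖ ^ 2 =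
        ∑ i, ∑ l, ξ i ω * ξ l ω * η i l (y k ω, ybar k ω) := by
      rw [norm_smul_sum_smul_sq]
      simp only [Finset.mul_sum]
      exact Finset.sum_congr rfl fun i _ => Finset.sum_congr rfl fun l _ => mul_left_comm _ _ _
    rw [hlin, hquad]
  have hlin : ∑ i, ∫ ω, ξ i ω * ζ i (y k ω, ybar k ω) ∂Pr =
      p * ∫ ω, inner ℝ (gradient f (aggregate F g x (y k ω)))
        ((N : ℝ)⁻¹ • ∑ i, jump g x (y k ω, ybar k ω) i) ∂Pr := by
    have h1 : ∀ ω, inner ℝ (gradient f (aggregate F g x (y k ω)))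
        ((N : ℝ)⁻¹ • ∑ i, jump g x (y k ω, ybar k ω) i) = ∑ i, ζ i (y k ω, ybar k ω) := fun ω => by
      rw [real_inner_smul_right, inner_sum, Finset.mul_sum]
    simp only [h1]
    rw [integral_finsetSum _ fun i _ => hζi i, Finset.mul_sum]
    exact Finset.sum_congr rfl fun i _ => hrun.integral_bernoulli_mul hk j i (hζ i)
  have hquad : ∑ i, ∑ l, ∫ ω, ξ i ω * ξ l ω * η i l (y k ω, ybar k ω) ∂Pr ≤
      D * (p ^ 2 + p * (1 - p) / N) := by
    -- All `N ^ 2` pairs contribute `p ^ 2`; the `N` diagonal ones add the variance `p - p ^ 2`,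
    -- which after division by `N ^ 2` is the `p * (1 - p) / N` term.
    have h1 : ∀ i l, ∫ ω, ξ i ω * ξ l ω * η i l (y k ω, ybar k ω) ∂Pr ≤
        (p ^ 2 + if i = l then p - p ^ 2 else 0) * (((N : ℝ)⁻¹) ^ 2 * D) := fun i l => by
      rw [hrun.integral_bernoulli_mul_mul hk j i l (hη i l)]
      refine mul_le_mul_of_nonneg_left (hηint i l) ?_
      split_ifs <;> nlinarith
    refine (Finset.sum_le_sum fun i _ => Finset.sum_le_sum fun l _ => h1 i l).trans
      (le_of_eq ?_)
    simp only [← Finset.sum_mul, Finset.sum_add_distrib, Finset.sum_ite_eq, Finset.sum_const,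
      Finset.card_univ, Fintype.card_fin, Finset.mem_univ, if_true, nsmul_eq_mul]
    field_simp
  calc ∫ ω, f (aggregate F g x (y (k + 1) ω)) ∂Pr
      ≤ ∫ ω, (f (aggregate F g x (y k ω)) + ∑ i, ξ i ω * ζ i (y k ω, ybar k ω) +
          L / 2 * ∑ i, ∑ l, ξ i ω * ξ l ω * η i l (y k ω, ybar k ω)) ∂Pr :=
        integral_mono (integrable_cost h₁ hg hrun hk) ((hcost.add hS1).add (hS2.const_mul _)) hpoint
    _ = ∫ ω, f (aggregate F g x (y k ω)) ∂Pr + ∑ i, ∫ ω, ξ i ω * ζ i (y k ω, ybar k ω) ∂Pr +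
          L / 2 * ∑ i, ∑ l, ∫ ω, ξ i ω * ξ l ω * η i l (y k ω, ybar k ω) ∂Pr := by
        have hS : Integrable (fun ω => f (aggregate F g x (y k ω)) +
            ∑ i, ξ i ω * ζ i (y k ω, ybar k ω)) Pr := hcost.add hS1
        rw [integral_add hS (hS2.const_mul _), integral_add hcost hS1,
          integral_const_mul, integral_finsetSum _ fun i _ => hξζ i,
          integral_finsetSum _ fun i _ => integrable_finsetSum _ fun l _ => hξη i l]
        congr 2
        exact Finset.sum_congr rfl fun i _ => integral_finsetSum _ fun l _ => hξη i l
    _ ≤ _ := by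
        rw [hlin]
        have := mul_le_mul_of_nonneg_left hquad (by positivity : (0 : ℝ) ≤ L / 2)
        linarith

variable [MeasurableSpace X] [BorelSpace X] [SecondCountableTopology X]

/-- Convergence of the stochastic Frank–Wolfe algorithm for the discretized problem. -/
theorem integral_cost_le (h₁ : Assumption1 F g f L) (hg : Continuous g)
    (hrun : IsSFWRun F g f x K n Pr y ybar P) (hK : 1 ≤ K) (hKN : K ≤ 2 * N)
    {μ : Measure (graph F)} (hμ : μ ∈ admissible F (empirical x)) :
    ∫ ω, f (aggregate F g x (y K ω)) ∂Pr ≤ f (∫ z, g z ∂μ) + 4 * (L * constD F g) / K := by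
  -- The gap is measured against one fixed competitor `μ`, so the discretized problem needs no
  -- minimizer.
  have hrec := le_div_of_frankWolfe_recursion
    (e := fun k => ∫ ω, f (aggregate F g x (y k ω)) ∂Pr - f (∫ z, g z ∂μ))
    (c := L * constD F g) (mul_nonneg L.coe_nonneg constD_nonneg) (NeZero.pos N) hK hKN
    fun k hk => ?_
  · linarith
  have h1 := hrun.integral_cost_succ_le h₁ hg hk
  have hcost := hrun.integrable_cost h₁ hg hk.le
  have hgap : ∫ ω, inner ℝ (gradient f (aggregate F g x (y k ω)))
      ((N : ℝ)⁻¹ • ∑ i, jump g x (y k ω, ybar k ω) i) ∂Pr ≤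
      f (∫ z, g z ∂μ) - ∫ ω, f (aggregate F g x (y k ω)) ∂Pr := by
    have h2 : ∫ ω, (f (∫ z, g z ∂μ) - f (aggregate F g x (y k ω))) ∂Pr =
        f (∫ z, g z ∂μ) - ∫ ω, f (aggregate F g x (y k ω)) ∂Pr := by
      rw [integral_sub (integrable_const _) hcost]
      simp
    rw [← h2]
    obtain ⟨R, hR⟩ := h₁.bounded
    refine integral_mono ?_ ((integrable_const _).sub hcost) fun ω =>
      inner_gradient_jump_le h₁ hg (hrun.best_response k hk ω) hμ
    have hcont : Continuous fun q : ((i : Fin N) → F (x i)) × ((i : Fin N) → F (x i)) =>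
        inner ℝ (gradient f (aggregate F g x q.1)) ((N : ℝ)⁻¹ • ∑ i, jump g x q i) :=
      (h₁.lipschitz_gradient.continuous.comp ((continuous_aggregate hg).comp continuous_fst)).inner
        ((continuous_finsetSum _ fun i _ => continuous_jump hg i).const_smul _)
    refine hrun.integrable_comp_profile hk hcont
      (A := (‖gradient f 0‖ + L * R) * (R + R)) fun q => ?_
    have h3 := norm_gradient_le (f := f) h₁.lipschitz_gradient (norm_aggregate_le hR q.1)
    have h4 : (N : ℝ)⁻¹ • ∑ i, jump g x q i = aggregate F g x q.2 - aggregate F g x q.1 := by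
      simp only [jump, Finset.sum_sub_distrib, smul_sub]
      rfl
    rw [h4]
    exact (norm_inner_le_norm _ _).trans (mul_le_mul h3 ((norm_sub_le _ _).trans
      (add_le_add (norm_aggregate_le hR _) (norm_aggregate_le hR _))) (norm_nonneg _)
      ((norm_nonneg _).trans h3))
  have hp : ((stepSize k : unitInterval) : ℝ) = 2 / ((k : ℝ) + 2) := rfl
  have h5 := mul_le_mul_of_nonneg_left hgap (stepSize k).2.1
  rw [← hp]
  simp only [sub_mul, mul_sub, one_mul] at h1 h5 ⊢
  linarith

end IsSFWRun

end Run

/-! ### Variation of the cost with the aggregate -/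

section Cost

variable {X Y H : Type*} [TopologicalSpace X] [MeasurableSpace X] [TopologicalSpace Y]
  [MeasurableSpace Y] [NormedAddCommGroup H] [InnerProductSpace ℝ H] [CompleteSpace H]
  {F : X → Set Y} {g : graph F → H} {f : H → ℝ} {L : ℝ≥0}

theorem norm_gradient_integral_le_constC (h₁ : Assumption1 F g f L) (μ : Measure (graph F))
    [hμ : IsProbabilityMeasure μ] : ‖gradient f (∫ z, g z ∂μ)‖ ≤ constC F g f := by
  obtain ⟨R, hR⟩ := h₁.bounded
  have hbdd : BddAbove (Set.range fun μ : ProbabilityMeasure (graph F) =>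
      ‖gradient f (∫ z, g z ∂(μ : Measure (graph F)))‖) := by
    refine ⟨‖gradient f 0‖ + L * R, Set.forall_mem_range.2 fun μ =>
      norm_gradient_le h₁.lipschitz_gradient ?_⟩
    simpa using norm_integral_le_of_norm_le_const (μ := (μ : Measure (graph F)))
      (Filter.Eventually.of_forall hR)
  exact le_ciSup hbdd ⟨μ, hμ⟩

/-- The variation of the cost is controlled by the variation of the aggregate. -/
theorem cost_sub_le (h₁ : Assumption1 F g f L) (μ : Measure (graph F)) [IsProbabilityMeasure μ]
    {a : H} {c : ℝ} (hc : ‖∫ z, g z ∂μ - a‖ ≤ c) :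
    f (∫ z, g z ∂μ) - f a ≤ constC F g f * c := by
  -- The tangent is taken at the aggregate of `μ`, where `constC` bounds the gradient; thus no
  -- second-order term appears and `a` may be arbitrary.
  have h1 := h₁.convex.add_inner_gradient_le h₁.differentiable a (∫ z, g z ∂μ)
  have h2 := norm_gradient_integral_le_constC h₁ μ
  rw [← neg_sub (∫ z, g z ∂μ) a, inner_neg_right] at h1
  have h3 := real_inner_le_norm (gradient f (∫ z, g z ∂μ)) (∫ z, g z ∂μ - a)
  have h4 := mul_le_mul h2 hc (norm_nonneg _) ((norm_nonneg _).trans h2)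
  linarith

end Cost

end MFO

/-! ### The main result -/

/-- A measurable family of probability measures is a Markov kernel, so its aggregate is measurable
in `ω`; boundedness of `g` then bounds the cost. -/
theorem MFO.integrable_cost_of_measurable {X Y H Ω : Type*} [MetricSpace X] [MeasurableSpace X]
    [BorelSpace X] [SecondCountableTopology X] [MetricSpace Y] [MeasurableSpace Y] [BorelSpace Y]
    [SecondCountableTopology Y] [NormedAddCommGroup H] [InnerProductSpace ℝ H] [CompleteSpace H]
    {F : X → Set Y} {g : graph F → H} {f : H → ℝ} {L : ℝ≥0} [MeasurableSpace Ω]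
    {Pr : Measure Ω} [IsFiniteMeasure Pr] (h₁ : Assumption1 F g f L) (hg : Continuous g)
    {μt : Ω → Measure (graph F)} (hμt : Measurable μt) [hprob : ∀ ω, IsProbabilityMeasure (μt ω)] :
    Integrable (fun ω => f (∫ z, g z ∂(μt ω))) Pr := by
  obtain ⟨R, hR⟩ := h₁.bounded
  obtain ⟨A, hA⟩ := exists_abs_le_of_norm_le h₁.convex h₁.differentiable h₁.lipschitz_gradient R
  let κ : Kernel Ω (graph F) := ⟨μt, hμt⟩
  have : IsMarkovKernel κ := ⟨hprob⟩
  have hmeas : StronglyMeasurable fun ω => ∫ z, g z ∂(κ ω) := hg.stronglyMeasurable.integral_kernel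
  refine .of_bound
    (h₁.differentiable.continuous.comp_stronglyMeasurable hmeas).aestronglyMeasurable A
    (Filter.Eventually.of_forall fun ω => hA _ ?_)
  simpa using norm_integral_le_of_norm_le_const (μ := μt ω) (Filter.Eventually.of_forall hR)

theorem theorem6p1
    {E Y H Ω : Type*}
    [NormedAddCommGroup E] [NormedSpace ℝ E] [CompleteSpace E]
    [TopologicalSpace.SeparableSpace E] [MeasurableSpace E] [BorelSpace E]
    [MetricSpace Y] [CompleteSpace Y] [TopologicalSpace.SeparableSpace Y]
    [MeasurableSpace Y] [BorelSpace Y]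
    [NormedAddCommGroup H] [InnerProductSpace ℝ H] [CompleteSpace H]
    [TopologicalSpace.SeparableSpace H]
    -- the data of the problem
    (X : Set E) (hX : IsClosed X)
    (F : X → Set Y) (hF : MFO.IsData F)
    (g : MFO.graph F → H) (f : H → ℝ) (L Lg : ℝ≥0)
    (h₁ : MFO.Assumption1 F g f L) (h₂ : MFO.Assumption2 F g Lg)
    (m : Measure X) [IsProbabilityMeasure m] (hm : MFO.HasFirstMoment m)
    -- the discretization, and a run of the stochastic Frank–Wolfe algorithm
    (N : ℕ) (x : Fin N → X) (K : ℕ) (hK : 1 ≤ K) (hKN : K ≤ 2 * N) (n : ℕ → ℕ)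
    [MeasurableSpace Ω] (Pr : Measure Ω) [IsProbabilityMeasure Pr]
    (y ybar : ℕ → Ω → (i : Fin N) → F (x i))
    (P : (k : ℕ) → Fin (n k) → Fin N → Ω → Bool)
    (hrun : MFO.IsSFWRun F g f x K n Pr y ybar P) :
    -- the bridging method can be carried out
    (∃ μt : Ω → Measure (MFO.graph F), Measurable μt ∧
      ∀ ω, MFO.IsBridgingOutput F g Lg (MFO.empirical x) m
        (MFO.empirical fun i => MFO.pt F (x i) (y K ω i)) (μt ω)) ∧
    -- and each of its (random) outputs is admissible and satisfies the estimate
    ∀ μt : Ω → Measure (MFO.graph F), Measurable μt →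
      (∀ ω, MFO.IsBridgingOutput F g Lg (MFO.empirical x) m
        (MFO.empirical fun i => MFO.pt F (x i) (y K ω i)) (μt ω)) →
      (∀ ω, μt ω ∈ MFO.admissible F m) ∧
      Integrable (fun ω => f (∫ z, g z ∂(μt ω))) Pr ∧
      (∫ ω, f (∫ z, g z ∂(μt ω)) ∂Pr) - MFO.val F g f m ≤
        4 * L * MFO.constD F g / K +
          2 * Lg * (MFO.constC F g f + L * MFO.constM F g) * MFO.d1 (MFO.empirical x) m := by
  -- `N = 0` is excluded by `1 ≤ K ≤ 2 * N`.
  have : NeZero N := ⟨by omega⟩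
  have : SecondCountableTopology E := UniformSpace.secondCountable_of_separable E
  have : SecondCountableTopology Y := UniformSpace.secondCountable_of_separable Y
  have hg := h₂.continuous
  obtain ⟨R, hR⟩ := h₁.bounded
  have hex := MFO.exists_measurable_isBridgingOutput (x := x) hF h₂ hm
    (hrun.measurable_y K le_rfl)
  refine ⟨hex, fun μt hμt hout => ?_⟩
  have hbridge := fun ω => (hout ω).mem_admissible_and_norm_le hg hR hm
  have hprob : ∀ ω, IsProbabilityMeasure (μt ω) := fun ω => (hbridge ω).1.1
  have hint : Integrable (fun ω => f (∫ z, g z ∂(μt ω))) Pr :=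
    MFO.integrable_cost_of_measurable h₁ hg hμt
  refine ⟨fun ω => (hbridge ω).1, hint, ?_⟩
  set c : ℝ := MFO.constC F g f * (Lg * MFO.d1 (MFO.empirical x) m) with hc
  have hcost : ∀ ω, f (∫ z, g z ∂(μt ω)) ≤ f (MFO.aggregate F g x (y K ω)) + c := fun ω => by
    have h := MFO.cost_sub_le h₁ (μt ω) (hbridge ω).2
    rw [MFO.integral_empirical _ hg.stronglyMeasurable] at h
    change f _ - f (MFO.aggregate F g x (y K ω)) ≤ c at h
    linarith
  have hagg := hrun.integrable_cost h₁ hg le_rfl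
  have hE : ∫ ω, f (∫ z, g z ∂(μt ω)) ∂Pr ≤
      ∫ ω, f (MFO.aggregate F g x (y K ω)) ∂Pr + c := by
    refine (integral_mono hint (hagg.add (integrable_const c)) hcost).trans (le_of_eq ?_)
    simp only [Pi.add_apply]
    rw [integral_add hagg (integrable_const c)]
    simp
  have hval : ∫ ω, f (∫ z, g z ∂(μt ω)) ∂Pr - (4 * (L * MFO.constD F g) / K + 2 * c) ≤
      MFO.val F g f m := by
    -- An output of the bridging method shows that the infimum defining `val` runs over a non-empty
    -- set. Each competitor is then compared with its bridged version over `m_N`, which costs a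
    -- second `c`.
    obtain ⟨ω₀⟩ := nonempty_of_isProbabilityMeasure Pr
    have : Nonempty (MFO.admissible F m) := ⟨⟨μt ω₀, (hbridge ω₀).1⟩⟩
    refine le_ciInf fun μ => ?_
    obtain ⟨μ', hμ', hclose⟩ := MFO.exists_admissible_empirical_norm_le hF h₂ hR hm x μ.2
    have := hμ'.1
    have h1 := MFO.cost_sub_le h₁ μ' hclose
    have h2 := hrun.integral_cost_le h₁ hg hK hKN hμ'
    linarith
  -- The argument already gives the transport error `2 * c`, with the constant `constC` alone; the
  -- term in `L * constM` is nonnegative slack.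
  have hM : 0 ≤ (L : ℝ) * MFO.constM F g :=
    mul_nonneg L.coe_nonneg (Real.iSup_nonneg fun _ => norm_nonneg _)
  have hd := mul_nonneg Lg.coe_nonneg (MFO.d1_nonneg hm x)
  have hslack := mul_nonneg hM hd
  have hfinal : 4 * (L : ℝ) * MFO.constD F g / K + 2 * Lg * (MFO.constC F g f +
      L * MFO.constM F g) * MFO.d1 (MFO.empirical x) m =
      4 * (L * MFO.constD F g) / K + 2 * c +
        2 * (L * MFO.constM F g * (Lg * MFO.d1 (MFO.empirical x) m)) := by
    rw [hc]
    ring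
  rw [hfinal]
  linarith
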